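/- Consider the Cauchy problem for the equations of plane one-dimensional relativistic oscillations of a cold plasma, $$P_\theta+V P_\rho+E=0,\qquad E_\theta+V E_\rho-V=0,\qquad V=\frac{P}{\sqrt{1+P^2}},\qquad \rho\in\mathbb R,\ \theta>0,$$ with initial data $P(\rho,0)=P_0(\rho)$, $E(\rho,0)=E_0(\rho)$, where $P_0,E_0\in C^1(\mathbb R)$ have uniformly bounded derivatives on $\mathbb R$. There is an $\varepsilon>0$ such that, whenever $|P_0(\rho)|\le\varepsilon$ and $|E_0(\rho)|\le\varepsilon$ for all $\rho\in\mathbb R$ (a small deviation from the equilibrium $P=E=0$) and the function $2\sqrt{1+P_0^2}+E_0^2$ is not identically constant on $\mathbb R$, the derivatives of the solution become infinite in a finite time. Precisely: there are a finite $T>0$ and a $C^1$ solution $(P,E)$ on $\mathbb R\times[0,T)$ such that every $C^1$ solution with the same data on a strip $\mathbb R\times[0,T')$ satisfies $T'\le T$ and coincides with $(P,E)$ there, and $$\sup_{\rho\in\mathbb R}\bigl(|P_\rho(\rho,\theta)|+|E_\rho(\rho,\theta)|\bigr)\to\infty\quad\text{as }\theta\uparrow T .$$ -/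

import Mathlib

namespace ColdPlasma

open Set Filter Topology
open scoped ENNReal

/-- The dimensionless electron velocity `V = P / √(1 + P²)` belonging to the momentum `P`. -/
noncomputable def velocity (P : ℝ) : ℝ := P / Real.sqrt (1 + P ^ 2)

/-- The energy `2 √(1 + P²) + E²`. -/
noncomputable def energy (P E : ℝ) : ℝ := 2 * Real.sqrt (1 + P ^ 2) + E ^ 2

/-- Admissible initial data: a `C¹` function on the line with uniformly bounded derivative. -/
def IsAdmissibleDatum (f : ℝ → ℝ) : Prop :=
  ContDiff ℝ 1 f ∧ ∃ L : ℝ, ∀ ρ : ℝ, |deriv f ρ| ≤ L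

/-- The functions `P` and `E` of `(ρ, θ)` (position, time) form a `C¹` solution on `ℝ × [0, T)`
(continuously differentiable up to `θ = 0`) of the relativistic cold plasma equations
`P_θ + V P_ρ + E = 0`, `E_θ + V E_ρ - V = 0`, `V = P / √(1 + P²)`,
with initial data `P(ρ, 0) = P₀(ρ)`, `E(ρ, 0) = E₀(ρ)`. -/
structure IsC1Solution (P₀ E₀ : ℝ → ℝ) (T : ℝ) (P E : ℝ × ℝ → ℝ) : Prop where
  contDiffOn_P : ContDiffOn ℝ 1 P (univ ×ˢ Ico 0 T)
  contDiffOn_E : ContDiffOn ℝ 1 E (univ ×ˢ Ico 0 T)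
  eq_P : ∀ ρ : ℝ, ∀ θ ∈ Ioo 0 T,
    deriv (fun s => P (ρ, s)) θ + velocity (P (ρ, θ)) * deriv (fun r => P (r, θ)) ρ
      + E (ρ, θ) = 0
  eq_E : ∀ ρ : ℝ, ∀ θ ∈ Ioo 0 T,
    deriv (fun s => E (ρ, s)) θ + velocity (P (ρ, θ)) * deriv (fun r => E (r, θ)) ρ
      - velocity (P (ρ, θ)) = 0
  init_P : ∀ ρ : ℝ, P (ρ, 0) = P₀ ρ
  init_E : ∀ ρ : ℝ, E (ρ, 0) = E₀ ρ

/-- `sup_ρ (|P_ρ(ρ, θ)| + |E_ρ(ρ, θ)|)`, with values in `[0, ∞]`. -/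
noncomputable def gradSup (P E : ℝ × ℝ → ℝ) (θ : ℝ) : ℝ≥0∞ :=
  ⨆ ρ : ℝ, ENNReal.ofReal (|deriv (fun r => P (r, θ)) ρ| + |deriv (fun r => E (r, θ)) ρ|)

/-- The solution with initial data `(P₀, E₀)` loses smoothness at the finite time `T`: there is a
`C¹` solution on `ℝ × [0, T)`, every `C¹` solution with the same data lives on a time interval
contained in `[0, T)` and is a restriction of it (it is the unique maximal `C¹` solution), and its
spatial derivatives become infinite as `θ ↑ T`. -/
def DerivativesBlowUpAt (P₀ E₀ : ℝ → ℝ) (T : ℝ) : Prop :=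
  0 < T ∧ ∃ P E : ℝ × ℝ → ℝ,
    IsC1Solution P₀ E₀ T P E ∧
    (∀ (T' : ℝ) (Q F : ℝ × ℝ → ℝ), IsC1Solution P₀ E₀ T' Q F →
      T' ≤ T ∧ EqOn Q P (univ ×ˢ Ico 0 T') ∧ EqOn F E (univ ×ˢ Ico 0 T')) ∧
    Tendsto (gradSup P E) (𝓝[<] T) (𝓝 ⊤)

end ColdPlasma

/-! Along the characteristics, which move with velocity `V`, the system becomes the ordinary
differential equation `P' = -E`, `E' = V(P)`, whose oscillations exist for all times; the position
on the characteristic starting at `x` is `X = x - E₀(x) + E`. Hence the solution lives exactly as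
long as the Jacobian `J = ∂X/∂x = 1 - E₀' + b` is positive, where `(a, b)` is the derivative of
`(P, E)` with respect to `x`, a solution of the linearized equation.

The linearized equation conserves `h = V a + E b`, half the derivative of the energy along the
data. Since the period of a relativistic oscillation depends on its energy, neighbouring
oscillations drift out of phase if `h ≠ 0`: the component `α` of `(a, b)` tangent to the energy
level satisfies `α' = -h V³ P / D²` with `D = P V + E²`, so that `h α → -∞` by the virial identity
`(P E)' = P V - E²`. As `h V` is bounded below by a positive constant once in every period, `b` is
unbounded below and `J` reaches zero.

The gradient of the solution satisfies `J (P_ρ, E_ρ) = (a, b)`. Since `(a, b)` changes by a factor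
of at least `e⁻ᵗ` in time `t`, it cannot be small where `J` is, so the gradient blows up as
`J → 0`. -/

namespace ColdPlasma

open Set Filter Topology
open scoped ENNReal NNReal Manifold

section ODE

variable {E : Type*} [NormedAddCommGroup E] [NormedSpace ℝ E]

theorem norm_le_gronwallBound_abs {f f' : ℝ → E} {δ K ε T : ℝ} (h0 : ‖f 0‖ ≤ δ)
    (hf : ∀ t, |t| ≤ T → HasDerivAt f (f' t) t)
    (bound : ∀ t, |t| ≤ T → ‖f' t‖ ≤ K * ‖f t‖ + ε) {t : ℝ} (ht : |t| ≤ T) :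
    ‖f t‖ ≤ gronwallBound δ K ε |t| := by
  have forward {g g' : ℝ → E} (hg0 : ‖g 0‖ ≤ δ) (hg : ∀ t, |t| ≤ T → HasDerivAt g (g' t) t)
      (hb : ∀ t, |t| ≤ T → ‖g' t‖ ≤ K * ‖g t‖ + ε) {t : ℝ} (ht0 : 0 ≤ t) (htT : t ≤ T) :
      ‖g t‖ ≤ gronwallBound δ K ε t := by
    have hmem : ∀ s ∈ Icc 0 t, |s| ≤ T := fun s hs =>
      (abs_of_nonneg hs.1).trans_le (hs.2.trans htT)
    simpa using norm_le_gronwallBound_of_norm_deriv_right_le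
      (fun s hs => (hg s (hmem s hs)).continuousAt.continuousWithinAt)
      (fun s hs => (hg s (hmem s (Ico_subset_Icc_self hs))).hasDerivWithinAt) hg0
      (fun s hs => hb s (hmem s (Ico_subset_Icc_self hs))) t ⟨ht0, le_rfl⟩
  rcases le_total 0 t with ht0 | ht0
  · rw [abs_of_nonneg ht0] at ht ⊢
    exact forward h0 hf bound ht0 ht
  · rw [abs_of_nonpos ht0] at ht ⊢
    have hreflect : ∀ s, |s| ≤ T → HasDerivAt (fun s => f (-s)) (-f' (-s)) s := fun s hs => by
      simpa [Function.comp_def] using (hf (-s) (by simpa using hs)).scomp s (hasDerivAt_neg s)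
    simpa using forward (by simpa using h0) hreflect
      (fun s hs => by simpa using bound (-s) (by simpa using hs)) (neg_nonneg.2 ht0) ht

theorem norm_le_norm_mul_exp {f f' : ℝ → E} {K : ℝ} (hf : ∀ t, HasDerivAt f (f' t) t)
    (bound : ∀ t, ‖f' t‖ ≤ K * ‖f t‖) (s t : ℝ) :
    ‖f t‖ ≤ ‖f s‖ * Real.exp (K * |t - s|) := by
  have h := norm_le_gronwallBound_abs (f := fun r => f (s + r)) (ε := 0) le_rfl
    (fun r _ => (hf (s + r)).comp_const_add s r) (fun r _ => by simpa using bound (s + r))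
    (le_refl |t - s|)
  simpa [gronwallBound_ε0] using h

theorem eqOn_zero_of_norm_deriv_le {f f' : ℝ → E} {a b K : ℝ} (hc : ContinuousOn f (Ico a b))
    (hf : ∀ t ∈ Ioo a b, HasDerivAt f (f' t) t)
    (bound : ∀ t ∈ Ioo a b, ‖f' t‖ ≤ K * ‖f t‖) (ha : f a = 0) : EqOn f 0 (Ico a b) := by
  intro t ht
  rcases eq_or_lt_of_le ht.1 with rfl | hat
  · exact ha
  have hlim : Tendsto (fun r => ‖f r‖ * Real.exp (K * (t - r))) (𝓝[>] a) (𝓝 0) := by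
    have hfa : Tendsto (fun r => ‖f r‖) (𝓝[>] a) (𝓝 0) := by
      have h := (hc a ⟨le_rfl, hat.trans ht.2⟩).mono_of_mem_nhdsWithin
        (mem_of_superset (Ioo_mem_nhdsGT (hat.trans ht.2)) Ioo_subset_Ico_self)
      simpa [ha] using h.tendsto.norm
    have hexp : Continuous fun r => Real.exp (K * (t - r)) := by fun_prop
    simpa using hfa.mul (hexp.continuousWithinAt (s := Ioi a) (x := a)).tendsto
  have hle : ∀ᶠ r in 𝓝[>] a, ‖f t‖ ≤ ‖f r‖ * Real.exp (K * (t - r)) := by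
    filter_upwards [Ioo_mem_nhdsGT hat] with r hr
    have hsub : Icc r t ⊆ Ioo a b := fun s hs => ⟨hr.1.trans_le hs.1, hs.2.trans_lt ht.2⟩
    simpa [gronwallBound_ε0] using norm_le_gronwallBound_of_norm_deriv_right_le (ε := 0)
      (fun s hs => (hf s (hsub hs)).continuousAt.continuousWithinAt)
      (fun s hs => (hf s (hsub (Ico_subset_Icc_self hs))).hasDerivWithinAt) le_rfl
      (fun s hs => by simpa using bound s (hsub (Ico_subset_Icc_self hs))) t ⟨hr.2.le, le_rfl⟩
  exact norm_le_zero_iff.1 (ge_of_tendsto hlim hle)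

section Flow

variable [FiniteDimensional ℝ E] {F : E → E} {K C : ℝ≥0}

theorem exists_hasDerivAt_of_norm_le (hF : ContDiff ℝ 1 F) (hb : ∀ x, ‖F x‖ ≤ K * ‖x‖ + C)
    (x : E) : ∃ γ : ℝ → E, γ 0 = x ∧
      ∀ t ∈ Ioo (-(2 * K + C + 1 : ℝ)⁻¹) (2 * K + C + 1 : ℝ)⁻¹, HasDerivAt γ (F (γ t)) t := by
  have : CompleteSpace E := FiniteDimensional.complete ℝ E
  have : ProperSpace E := FiniteDimensional.proper ℝ E
  obtain ⟨L, hL⟩ := hF.contDiffOn.exists_lipschitzOnWith (s := Metric.closedBall x (‖x‖₊ + 1))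
    one_ne_zero (convex_closedBall _ _) (isCompact_closedBall _ _)
  have hPL : IsPicardLindelof (fun _ => F)
      (tmin := -(2 * K + C + 1 : ℝ)⁻¹) (tmax := (2 * K + C + 1 : ℝ)⁻¹)
      ⟨0, by constructor <;> norm_num <;> positivity⟩ x
      (‖x‖₊ + 1) 0 (K * (2 * ‖x‖₊ + 1) + C) L := by
    refine IsPicardLindelof.of_time_independent (fun y hy => ?_) (by simpa using hL) ?_
    · have hyx : ‖y - x‖ ≤ ‖x‖ + 1 := by simpa [dist_eq_norm] using hy
      have hy' : ‖y‖ ≤ 2 * ‖x‖ + 1 := by linarith [norm_le_norm_sub_add y x]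
      push_cast
      exact (hb y).trans (by gcongr)
    · have hC := C.coe_nonneg
      push_cast
      rw [sub_zero, zero_sub, neg_neg, max_self, sub_zero, ← div_eq_mul_inv,
        div_le_iff₀ (by positivity)]
      nlinarith [norm_nonneg x, mul_nonneg hC (norm_nonneg x)]
  obtain ⟨γ, h0, hγ⟩ := hPL.exists_eq_forall_mem_Icc_hasDerivWithinAt₀
  exact ⟨γ, h0, fun t ht =>
    (hγ t (Ioo_subset_Icc_self ht)).hasDerivAt (Icc_mem_nhds ht.1 ht.2)⟩

theorem exists_isIntegralCurve_of_norm_le (hF : ContDiff ℝ 1 F)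
    (hb : ∀ x, ‖F x‖ ≤ K * ‖x‖ + C) (x : E) :
    ∃ γ : ℝ → E, γ 0 = x ∧ IsIntegralCurve γ fun _ => F := by
  have : CompleteSpace E := FiniteDimensional.complete ℝ E
  have hv : ContMDiff 𝓘(ℝ, E) 𝓘(ℝ, E).tangent 1
      (fun y => (⟨y, F y⟩ : TangentBundle 𝓘(ℝ, E) E)) :=
    contMDiff_vectorSpace_iff_contDiff.2 hF
  have hτ : 0 < (2 * K + C + 1 : ℝ)⁻¹ := by positivity
  obtain ⟨γ, h0, hγ⟩ := exists_isMIntegralCurve_of_isMIntegralCurveOn hv hτ (fun y => by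
    obtain ⟨γ, h0, hγ⟩ := exists_hasDerivAt_of_norm_le hF hb y
    exact ⟨γ, h0, fun t ht => (hγ t ht).hasDerivWithinAt.hasFDerivWithinAt.hasMFDerivWithinAt⟩) x
  refine ⟨γ, h0, fun t => ?_⟩
  have h : HasFDerivAt γ ((1 : ℝ →L[ℝ] ℝ).smulRight (F (γ t))) t :=
    hasMFDerivAt_iff_hasFDerivAt.1 (hγ t)
  simpa using h.hasDerivAt

theorem exists_norm_sub_le_mul_norm_sub (hF : ContDiff ℝ 1 F)
    (hb : ∀ x, ‖F x‖ ≤ K * ‖x‖ + C) (R T : ℝ≥0) :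
    ∃ M : ℝ, ∀ γ₁ γ₂ : ℝ → E, (IsIntegralCurve γ₁ fun _ => F) → (IsIntegralCurve γ₂ fun _ => F) →
      ‖γ₁ 0‖ ≤ R → ‖γ₂ 0‖ ≤ R → ∀ t : ℝ, |t| ≤ T → ‖γ₁ t - γ₂ t‖ ≤ M * ‖γ₁ 0 - γ₂ 0‖ := by
  have : ProperSpace E := FiniteDimensional.proper ℝ E
  obtain ⟨L, hL⟩ := hF.contDiffOn.exists_lipschitzOnWith
    (s := Metric.closedBall (0 : E) (gronwallBound R K C T))
    one_ne_zero (convex_closedBall _ _) (isCompact_closedBall _ _)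
  have hmem : ∀ γ : ℝ → E, (IsIntegralCurve γ fun _ => F) → ‖γ 0‖ ≤ R → ∀ t : ℝ, |t| ≤ T →
      γ t ∈ Metric.closedBall (0 : E) (gronwallBound R K C T) := by
    intro γ hγ hR t ht
    rw [mem_closedBall_zero_iff]
    exact (norm_le_gronwallBound_abs hR (fun s _ => hγ s) (fun s _ => hb _) ht).trans
      (gronwallBound_mono R.2 C.2 K.2 ht)
  refine ⟨Real.exp (L * T), fun γ₁ γ₂ h₁ h₂ hR₁ hR₂ t ht => ?_⟩
  have h := norm_le_gronwallBound_abs (f := fun s => γ₁ s - γ₂ s) (K := L) (ε := 0) le_rfl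
    (fun s _ => (h₁ s).sub (h₂ s))
    (fun s hs => by
      simpa using hL.norm_sub_le (hmem γ₁ h₁ hR₁ s hs) (hmem γ₂ h₂ hR₂ s hs)) ht
  rw [gronwallBound_ε0, mul_comm] at h
  exact h.trans (by gcongr)

theorem continuous_of_forall_isIntegralCurve (hF : ContDiff ℝ 1 F)
    (hb : ∀ x, ‖F x‖ ≤ K * ‖x‖ + C) {Γ : E → ℝ → E} (h0 : ∀ x, Γ x 0 = x)
    (hΓ : ∀ x, IsIntegralCurve (Γ x) fun _ => F) :
    Continuous fun q : E × ℝ => Γ q.1 q.2 := by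
  rw [continuous_iff_continuousAt]
  rintro ⟨x, t⟩
  obtain ⟨M, hM⟩ := exists_norm_sub_le_mul_norm_sub hF hb (‖x‖₊ + 1) (‖t‖₊ + 1)
  rw [ContinuousAt, tendsto_iff_norm_sub_tendsto_zero]
  have hlim : Tendsto (fun q : E × ℝ => M * ‖q.1 - x‖ + ‖Γ x q.2 - Γ x t‖) (𝓝 (x, t)) (𝓝 0) := by
    have hΓx : Continuous (Γ x) := (hΓ x).continuous
    have hcont : Continuous fun q : E × ℝ => M * ‖q.1 - x‖ + ‖Γ x q.2 - Γ x t‖ := by fun_prop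
    simpa using hcont.tendsto (x, t)
  refine squeeze_zero' (Eventually.of_forall fun q => norm_nonneg _) ?_ hlim
  filter_upwards [Metric.ball_mem_nhds (x, t) one_pos] with q hq
  rw [Metric.mem_ball, Prod.dist_eq, max_lt_iff, dist_eq_norm, dist_eq_norm] at hq
  have hq1 : ‖q.1‖ ≤ (‖x‖₊ + 1 : ℝ≥0) := by
    push_cast
    linarith [norm_le_norm_sub_add q.1 x, hq.1]
  have hq2 : |q.2| ≤ (‖t‖₊ + 1 : ℝ≥0) := by
    push_cast
    rw [← Real.norm_eq_abs]
    linarith [norm_le_norm_sub_add q.2 t, hq.2]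
  have hdep := hM (Γ q.1) (Γ x) (hΓ _) (hΓ _) (by rwa [h0]) (by rw [h0]; simp) q.2 hq2
  rw [h0, h0] at hdep
  linarith [norm_sub_le_norm_sub_add_norm_sub (Γ q.1 q.2) (Γ x q.2) (Γ x t)]

end Flow

section Variation

variable {F : E → E} {F' : E → E →L[ℝ] E} {K L : ℝ≥0}

theorem norm_sub_sub_apply_le (hF : ∀ x, HasFDerivAt F (F' x) x) (hL : LipschitzWith L F')
    (x y : E) : ‖F y - F x - F' x (y - x)‖ ≤ L * ‖y - x‖ ^ 2 := by
  have h := (convex_segment x y).norm_image_sub_le_of_norm_hasFDerivWithin_le'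
    (fun z _ => (hF z).hasFDerivWithinAt) (φ := F' x) (C := L * ‖y - x‖)
    (fun z hz => (hL.norm_sub_le z x).trans (by
      gcongr
      exact norm_sub_le_of_mem_segment hz)) (left_mem_segment ℝ x y) (right_mem_segment ℝ x y)
  rwa [mul_assoc, ← sq] at h

theorem norm_sub_le_norm_sub_mul_exp (hF : LipschitzWith K F) {γ₁ γ₂ : ℝ → E}
    (h₁ : IsIntegralCurve γ₁ fun _ => F) (h₂ : IsIntegralCurve γ₂ fun _ => F) (s t : ℝ) :
    ‖γ₁ t - γ₂ t‖ ≤ ‖γ₁ s - γ₂ s‖ * Real.exp (K * |t - s|) :=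
  norm_le_norm_mul_exp (f := fun r => γ₁ r - γ₂ r) (fun r => (h₁ r).sub (h₂ r))
    (fun r => hF.norm_sub_le (γ₁ r) (γ₂ r)) s t

theorem gronwallBound_eq_add (δ K ε t : ℝ) :
    gronwallBound δ K ε t = δ * Real.exp (K * t) + ε * gronwallBound 0 K 1 t := by
  by_cases hK : K = 0
  · simp [gronwallBound, hK]
  · simp only [gronwallBound, hK, if_false]
    ring

theorem norm_sub_sub_smul_le (hF : ∀ x, HasFDerivAt F (F' x) x) (hK : ∀ x, ‖F' x‖ ≤ K)
    (hL : LipschitzWith L F') {γ₁ γ₂ w : ℝ → E} (h₁ : IsIntegralCurve γ₁ fun _ => F)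
    (h₂ : IsIntegralCurve γ₂ fun _ => F) (hw : IsIntegralCurve w fun t => F' (γ₁ t)) (c t : ℝ) :
    ‖γ₂ t - γ₁ t - c • w t‖ ≤ ‖γ₂ 0 - γ₁ 0 - c • w 0‖ * Real.exp (K * |t|) +
      L * (‖γ₂ 0 - γ₁ 0‖ * Real.exp (K * |t|)) ^ 2 * gronwallBound 0 K 1 |t| := by
  have hLip : LipschitzWith K F := lipschitzWith_of_nnnorm_fderiv_le
    (fun x => (hF x).differentiableAt) fun x => by rw [(hF x).fderiv]; exact hK x
  rw [← gronwallBound_eq_add]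
  refine norm_le_gronwallBound_abs (f := fun s => γ₂ s - γ₁ s - c • w s) le_rfl
    (fun s _ => ((h₂ s).sub (h₁ s)).sub ((hw s).const_smul c)) (fun s hs => ?_) (le_refl |t|)
  have hdist : ‖γ₂ s - γ₁ s‖ ≤ ‖γ₂ 0 - γ₁ 0‖ * Real.exp (K * |t|) := by
    have h := norm_sub_le_norm_sub_mul_exp hLip h₂ h₁ 0 s
    rw [sub_zero] at h
    exact h.trans (by gcongr)
  calc ‖F (γ₂ s) - F (γ₁ s) - c • F' (γ₁ s) (w s)‖
      = ‖F' (γ₁ s) (γ₂ s - γ₁ s - c • w s) +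
          (F (γ₂ s) - F (γ₁ s) - F' (γ₁ s) (γ₂ s - γ₁ s))‖ := by
        rw [map_sub (F' (γ₁ s)) (γ₂ s - γ₁ s), map_smul]
        abel_nf
    _ ≤ K * ‖γ₂ s - γ₁ s - c • w s‖ + L * ‖γ₂ s - γ₁ s‖ ^ 2 :=
        norm_add_le_of_le ((F' _).le_of_opNorm_le (hK _) _) (norm_sub_sub_apply_le hF hL _ _)
    _ ≤ _ := by gcongr

theorem hasDerivAt_of_hasDerivAt_zero (hF : ∀ x, HasFDerivAt F (F' x) x) (hK : ∀ x, ‖F' x‖ ≤ K)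
    (hL : LipschitzWith L F') {γ : ℝ → ℝ → E} {w : ℝ → E} {x : ℝ}
    (hγ : ∀ y, IsIntegralCurve (γ y) fun _ => F) (hw : IsIntegralCurve w fun t => F' (γ x t))
    (h0 : HasDerivAt (γ · 0) (w 0) x) (t : ℝ) : HasDerivAt (γ · t) (w t) x := by
  have hdist : (fun y => ‖γ y 0 - γ x 0‖ ^ 2) =o[𝓝 x] fun y => y - x := by
    have hsub : (fun y => y - x) =o[𝓝 x] fun _ => (1 : ℝ) := by
      rw [Asymptotics.isLittleO_one_iff]
      simpa using (continuous_sub_right x).tendsto x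
    have hO : (fun y => ‖γ y 0 - γ x 0‖) =O[𝓝 x] fun y => y - x := h0.isBigO_sub.norm_left
    simpa [sq] using hO.mul_isLittleO (hO.trans_isLittleO hsub)
  rw [hasDerivAt_iff_isLittleO] at h0 ⊢
  refine Asymptotics.IsBigO.trans_isLittleO (.of_norm_le fun y =>
    norm_sub_sub_smul_le hF hK hL (hγ x) (hγ y) hw (y - x) t) (.add ?_ ?_)
  · simpa only [mul_comm] using h0.norm_left.const_mul_left (Real.exp (K * |t|))
  · refine (hdist.const_mul_left
      (L * Real.exp (K * |t|) ^ 2 * gronwallBound 0 K 1 |t|)).congr_left fun y => by ring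

end Variation

end ODE

/-- The derivative `(1 + P²)^(-3/2)` of `velocity`. -/
noncomputable def velocityDeriv (P : ℝ) : ℝ := 1 / Real.sqrt (1 + P ^ 2) ^ 3

section Velocity

theorem one_le_sqrt_one_add_sq (p : ℝ) : 1 ≤ Real.sqrt (1 + p ^ 2) :=
  Real.one_le_sqrt.2 (le_add_of_nonneg_right (sq_nonneg p))

theorem sq_sqrt_one_add_sq (p : ℝ) : Real.sqrt (1 + p ^ 2) ^ 2 = 1 + p ^ 2 :=
  Real.sq_sqrt (by positivity)

theorem sqrt_one_add_sq_mul_velocity (p : ℝ) : Real.sqrt (1 + p ^ 2) * velocity p = p :=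
  mul_div_cancel₀ p (by positivity)

theorem hasDerivAt_sqrt_one_add_sq (p : ℝ) :
    HasDerivAt (fun p => Real.sqrt (1 + p ^ 2)) (velocity p) p := by
  refine (((hasDerivAt_pow 2 p).const_add 1).sqrt (by positivity)).congr_deriv ?_
  simp [velocity, mul_div_mul_left]

theorem hasDerivAt_velocity (p : ℝ) : HasDerivAt velocity (velocityDeriv p) p := by
  refine ((hasDerivAt_id p).div (hasDerivAt_sqrt_one_add_sq p) (by positivity)).congr_deriv ?_
  simp only [id, velocity, velocityDeriv]
  field_simp
  linarith [sq_sqrt_one_add_sq p]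

theorem contDiff_velocity {n : WithTop ℕ∞} : ContDiff ℝ n velocity :=
  contDiff_id.div (ContDiff.sqrt (by fun_prop) fun p => by positivity) fun p => by positivity

theorem contDiff_velocityDeriv {n : WithTop ℕ∞} : ContDiff ℝ n velocityDeriv :=
  contDiff_const.div ((ContDiff.sqrt (by fun_prop) fun p => by positivity).pow 3)
    fun p => by positivity

theorem abs_velocity_le_one (p : ℝ) : |velocity p| ≤ 1 := by
  rw [velocity, abs_div, abs_of_nonneg (Real.sqrt_nonneg _), div_le_one (by positivity)]
  exact Real.abs_le_sqrt (by linarith)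

theorem mul_velocity_nonneg (p : ℝ) : 0 ≤ p * velocity p := by
  rw [velocity, ← mul_div_assoc, ← sq]
  positivity

theorem velocityDeriv_mul_self (p : ℝ) : velocityDeriv p * p = velocity p - velocity p ^ 3 := by
  simp only [velocityDeriv, velocity]
  field_simp
  rw [sq_sqrt_one_add_sq]
  ring

theorem velocityDeriv_pos (p : ℝ) : 0 < velocityDeriv p := by
  unfold velocityDeriv
  positivity

theorem abs_velocityDeriv_le_one (p : ℝ) : |velocityDeriv p| ≤ 1 := by
  rw [abs_of_pos (velocityDeriv_pos p), velocityDeriv, div_le_one (by positivity)]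
  exact one_le_pow₀ (one_le_sqrt_one_add_sq p)

theorem abs_velocity_sub_le (p q : ℝ) : |velocity p - velocity q| ≤ |p - q| := by
  simpa using convex_univ.norm_image_sub_le_of_norm_hasDerivWithin_le
    (fun x _ => (hasDerivAt_velocity x).hasDerivWithinAt) (fun x _ => abs_velocityDeriv_le_one x)
    (mem_univ q) (mem_univ p)

theorem hasDerivAt_velocityDeriv (p : ℝ) :
    HasDerivAt velocityDeriv (-(3 * velocity p) / Real.sqrt (1 + p ^ 2) ^ 4) p := by
  refine ((hasDerivAt_const p (1 : ℝ)).fun_div ((hasDerivAt_sqrt_one_add_sq p).fun_pow 3)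
    (by positivity)).congr_deriv ?_
  push_cast
  field_simp
  ring

theorem lipschitzWith_velocityDeriv : LipschitzWith 3 velocityDeriv := by
  refine lipschitzWith_of_nnnorm_deriv_le (fun p => (hasDerivAt_velocityDeriv p).differentiableAt)
    fun p => ?_
  rw [(hasDerivAt_velocityDeriv p).deriv, ← NNReal.coe_le_coe, coe_nnnorm, Real.norm_eq_abs,
    abs_div, abs_neg, abs_mul, abs_of_nonneg (by norm_num : (0 : ℝ) ≤ 3),
    abs_of_nonneg (by positivity : 0 ≤ Real.sqrt (1 + p ^ 2) ^ 4)]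
  refine (div_le_self (by positivity) (one_le_pow₀ (one_le_sqrt_one_add_sq p))).trans ?_
  simpa using abs_velocity_le_one p

theorem velocity_pow_three_mul_nonneg (p : ℝ) : 0 ≤ velocity p ^ 3 * p := by
  have h := mul_nonneg (mul_velocity_nonneg p) (sq_nonneg (velocity p))
  linarith

theorem sq_mul_velocity_le {p B : ℝ} (hB : Real.sqrt (1 + p ^ 2) ≤ B) :
    (p * velocity p) ^ 2 ≤ B * (velocity p ^ 3 * p) := by
  have hp := sqrt_one_add_sq_mul_velocity p
  have hnonneg := velocity_pow_three_mul_nonneg p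
  calc (p * velocity p) ^ 2 = Real.sqrt (1 + p ^ 2) * (velocity p ^ 3 * p) := by
        linear_combination (-p * velocity p ^ 2) * hp
    _ ≤ B * (velocity p ^ 3 * p) := by gcongr

end Velocity

section Energy

theorem sqrt_one_add_sq_le_energy (p e : ℝ) : Real.sqrt (1 + p ^ 2) ≤ energy p e / 2 := by
  unfold energy
  linarith [sq_nonneg e]

theorem abs_fst_le_energy (p e : ℝ) : |p| ≤ energy p e / 2 :=
  (Real.abs_le_sqrt (by linarith)).trans (sqrt_one_add_sq_le_energy p e)

theorem abs_snd_le_energy (p e : ℝ) : |e| ≤ energy p e / 2 := by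
  unfold energy
  have hs := one_le_sqrt_one_add_sq p
  have he : 2 * |e| ≤ 1 + e ^ 2 := by
    rw [← sq_abs e]
    linarith [sq_nonneg (|e| - 1)]
  linarith [sq_nonneg e]

theorem energy_sub_two_le (p e : ℝ) :
    energy p e - 2 ≤ e ^ 2 + energy p e / 2 * (p * velocity p) := by
  have hs := one_le_sqrt_one_add_sq p
  have hsq : Real.sqrt (1 + p ^ 2) * (p * velocity p) = Real.sqrt (1 + p ^ 2) ^ 2 - 1 := by
    linear_combination p * sqrt_one_add_sq_mul_velocity p - sq_sqrt_one_add_sq p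
  have hmul := mul_le_mul_of_nonneg_right (sqrt_one_add_sq_le_energy p e) (mul_velocity_nonneg p)
  have henergy : energy p e = 2 * Real.sqrt (1 + p ^ 2) + e ^ 2 := rfl
  linarith [mul_nonneg (sub_nonneg.2 hs) (sub_nonneg.2 hs)]

/-- The rate `P E' - E P'` at which the position vector of an oscillation sweeps out (twice the)
area in the phase plane: its size measures how far the oscillation stays from the equilibrium. -/
noncomputable def arealVelocity (p e : ℝ) : ℝ := p * velocity p + e ^ 2

theorem energy_sub_two_le_mul_arealVelocity (p e : ℝ) :
    energy p e - 2 ≤ energy p e / 2 * arealVelocity p e := by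
  have hB := (one_le_sqrt_one_add_sq p).trans (sqrt_one_add_sq_le_energy p e)
  have he := mul_nonneg (sub_nonneg.2 hB) (sq_nonneg e)
  unfold arealVelocity
  linarith [energy_sub_two_le p e]

theorem arealVelocity_pos {p e : ℝ} (h : 2 < energy p e) : 0 < arealVelocity p e := by
  refine pos_of_mul_pos_right (?_ : 0 < energy p e / 2 * arealVelocity p e) (by linarith)
  linarith [energy_sub_two_le_mul_arealVelocity p e]

theorem arealVelocity_le (p e : ℝ) :
    arealVelocity p e ≤ energy p e / 2 + (energy p e / 2) ^ 2 := by
  refine add_le_add ?_ (by rw [← sq_abs]; gcongr; exact abs_snd_le_energy p e)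
  calc p * velocity p ≤ |p| * |velocity p| := by rw [← abs_mul]; exact le_abs_self _
    _ ≤ |p| := mul_le_of_le_one_right (abs_nonneg p) (abs_velocity_le_one p)
    _ ≤ energy p e / 2 := abs_fst_le_energy p e

/-- Half the derivative of the energy at `(p, e)` in the direction `(a, b)`. -/
noncomputable def linearizedEnergy (p e a b : ℝ) : ℝ := velocity p * a + e * b

theorem two_lt_energy_of_linearizedEnergy_ne_zero {p e a b : ℝ}
    (h : linearizedEnergy p e a b ≠ 0) : 2 < energy p e := by
  contrapose! h
  have hs := one_le_sqrt_one_add_sq p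
  have hsq := sq_sqrt_one_add_sq p
  unfold energy at h
  have he : e = 0 := by
    rw [← sq_eq_zero_iff]
    linarith [sq_nonneg e]
  have hs1 : Real.sqrt (1 + p ^ 2) = 1 := by linarith [sq_nonneg e]
  have hp : p = 0 := by
    rw [hs1] at hsq
    exact sq_eq_zero_iff.1 (by linarith)
  simp [linearizedEnergy, velocity, he, hp]

/-- The amount by which the phase of a neighbouring oscillation is ahead: the coefficient `α` in
the decomposition `(a, b) = α • (-e, V(p)) + β • (p, e)` of a variation, whose first term is tangent
to the energy level through `(p, e)`. -/
noncomputable def phaseShift (p e a b : ℝ) : ℝ := (b * p - a * e) / arealVelocity p e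

theorem eq_phaseShift_mul_velocity_add {p e : ℝ} (h : arealVelocity p e ≠ 0) (a b : ℝ) :
    b = phaseShift p e a b * velocity p + linearizedEnergy p e a b * e / arealVelocity p e := by
  unfold phaseShift linearizedEnergy
  field_simp
  unfold arealVelocity
  ring

end Energy

section Oscillation

theorem tendsto_atBot_of_hasDerivAt_le {G G' : ℝ → ℝ} {κ : ℝ} (hκ : 0 < κ)
    (hG : ∀ t, HasDerivAt G (G' t) t) (hle : ∀ᶠ t in atTop, G' t ≤ -κ) :
    Tendsto G atTop atBot := by
  obtain ⟨t₀, ht₀⟩ := eventually_atTop.1 hle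
  have hderiv (t : ℝ) : HasDerivAt (fun t => G t + κ * t) (G' t + κ) t :=
    ((hG t).add ((hasDerivAt_id t).const_mul κ)).congr_deriv (by rw [mul_one])
  have hanti : AntitoneOn (fun t => G t + κ * t) (Ici t₀) :=
    antitoneOn_of_hasDerivWithinAt_nonpos (convex_Ici t₀)
      (fun t _ => (hderiv t).continuousAt.continuousWithinAt)
      (fun t _ => (hderiv t).hasDerivWithinAt)
      fun t ht => by linarith [ht₀ t (interior_subset ht)]
  have hbound : ∀ᶠ t in atTop, G t ≤ (G t₀ + κ * t₀) + -(κ * t) := by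
    filter_upwards [eventually_ge_atTop t₀] with t ht
    linarith [hanti self_mem_Ici ht ht]
  exact tendsto_atBot_mono' _ hbound (tendsto_atBot_add_const_left _ _
    (tendsto_neg_atTop_atBot.comp (tendsto_id.const_mul_atTop hκ)))

/-- The pair of a momentum and a field seen by an electron moving along with the plasma: a
trajectory of the ordinary differential equation `P' = -E`, `E' = V(P)`. -/
structure IsOscillation (P E : ℝ → ℝ) : Prop where
  hasDerivAt_fst : ∀ t, HasDerivAt P (-E t) t
  hasDerivAt_snd : ∀ t, HasDerivAt E (velocity (P t)) t

/-- A solution `(a, b)` of the linearization of the equations of `IsOscillation` along an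
oscillation with momentum `P`. -/
structure IsVariation (P a b : ℝ → ℝ) : Prop where
  hasDerivAt_fst : ∀ t, HasDerivAt a (-b t) t
  hasDerivAt_snd : ∀ t, HasDerivAt b (velocityDeriv (P t) * a t) t

variable {P E a b : ℝ → ℝ}

theorem IsOscillation.energy_eq (h : IsOscillation P E) (t : ℝ) :
    energy (P t) (E t) = energy (P 0) (E 0) := by
  have hderiv (t : ℝ) : HasDerivAt (fun t => energy (P t) (E t)) 0 t := by
    refine ((((hasDerivAt_sqrt_one_add_sq (P t)).comp t (h.hasDerivAt_fst t)).const_mul 2).add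
      ((h.hasDerivAt_snd t).pow 2)).congr_deriv ?_
    push_cast
    ring
  exact is_const_of_deriv_eq_zero (fun t => (hderiv t).differentiableAt)
    (fun t => (hderiv t).deriv) t 0

theorem IsOscillation.hasDerivAt_mul (h : IsOscillation P E) (t : ℝ) :
    HasDerivAt (fun t => P t * E t) (P t * velocity (P t) - E t ^ 2) t :=
  ((h.hasDerivAt_fst t).mul (h.hasDerivAt_snd t)).congr_deriv (by ring)

theorem IsOscillation.abs_mul_le (h : IsOscillation P E) (t : ℝ) :
    |P t * E t| ≤ (energy (P 0) (E 0) / 2) ^ 2 := by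
  rw [abs_mul, sq, ← h.energy_eq t]
  exact mul_le_mul (abs_fst_le_energy _ _) (abs_snd_le_energy _ _) (abs_nonneg _)
    ((abs_nonneg _).trans (abs_fst_le_energy _ (E t)))

theorem IsOscillation.exists_forall_abs_div_arealVelocity_le (h : IsOscillation P E)
    (hen : 2 < energy (P 0) (E 0)) : ∃ C, ∀ t, |E t / arealVelocity (P t) (E t)| ≤ C := by
  refine ⟨(energy (P 0) (E 0) / 2) ^ 2 / (energy (P 0) (E 0) - 2), fun t => ?_⟩
  rw [← h.energy_eq t] at hen ⊢
  have hD := arealVelocity_pos hen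
  rw [abs_div, abs_of_pos hD, div_le_div_iff₀ hD (by linarith), sq, mul_assoc]
  exact mul_le_mul (abs_snd_le_energy _ _) (energy_sub_two_le_mul_arealVelocity _ _)
    (by linarith) (by linarith)

theorem abs_mul_mul_velocity_sub_sq_add_le (p e h : ℝ) :
    |h| * (p * velocity p - e ^ 2) +
        (1 + energy p e / 2) * (energy p e / 2) * (h * velocity p) ≤
      (1 + energy p e / 2) * (energy p e / 2) * (|h * velocity p| + h * velocity p) -
        2 * (|h| * (energy p e / 2 - 1)) := by
  have hB := (one_le_sqrt_one_add_sq p).trans (sqrt_one_add_sq_le_energy p e)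
  have hlow := mul_le_mul_of_nonneg_left (energy_sub_two_le p e) (abs_nonneg h)
  have hpv : |h| * (p * velocity p) ≤ energy p e / 2 * |h * velocity p| := by
    calc |h| * (p * velocity p) ≤ |h| * (|p| * |velocity p|) := by
          rw [← abs_mul p]
          exact mul_le_mul_of_nonneg_left (le_abs_self _) (abs_nonneg h)
      _ = |p| * |h * velocity p| := by rw [abs_mul]; ring
      _ ≤ _ := by gcongr; exact abs_fst_le_energy p e
  have hpv' := mul_le_mul_of_nonneg_left hpv (by linarith : 0 ≤ 1 + energy p e / 2)
  linarith

theorem IsOscillation.exists_frequently_le_mul_velocity (hPE : IsOscillation P E)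
    (hen : 2 < energy (P 0) (E 0)) {h : ℝ} (hh : h ≠ 0) :
    ∃ κ > 0, ∃ᶠ t in atTop, κ ≤ h * velocity (P t) := by
  have henergy := hPE.energy_eq
  have hPE_le := hPE.abs_mul_le
  set B := energy (P 0) (E 0) / 2 with hBdef
  have hB : 0 < B - 1 := by linarith
  have : 0 < B := by linarith
  have hh0 : 0 < |h| := abs_pos.2 hh
  refine ⟨|h| * (B - 1) / (2 * ((1 + B) * B)), by positivity, fun hcon => ?_⟩
  -- If `h V` stayed below the bound, the virial identity would make this bounded function tend
  -- to `-∞`: the mean of `P V - E²` vanishes along an oscillation.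
  have hvirial : Tendsto (fun t => |h| * (P t * E t) + (1 + B) * B * (h * E t)) atTop atBot := by
    refine tendsto_atBot_of_hasDerivAt_le (mul_pos hh0 hB)
      (fun t => ((hPE.hasDerivAt_mul t).const_mul |h|).add
        (((hPE.hasDerivAt_snd t).const_mul h).const_mul ((1 + B) * B))) ?_
    filter_upwards [hcon] with t ht
    have hle := abs_mul_mul_velocity_sub_sq_add_le (P t) (E t) h
    rw [henergy, ← hBdef] at hle
    rw [not_le, lt_div_iff₀ (by positivity)] at ht
    have hsum : (1 + B) * B * (|h * velocity (P t)| + h * velocity (P t)) ≤ |h| * (B - 1) := by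
      have hhB := mul_pos hh0 hB
      rcases abs_cases (h * velocity (P t)) with ⟨habs, -⟩ | ⟨habs, -⟩ <;> rw [habs] <;> linarith
    linarith
  obtain ⟨t, ht⟩ :=
    (hvirial.eventually_lt_atBot (-(|h| * B ^ 2 + (1 + B) * B * (|h| * B)))).exists
  have hE_le : |h * E t| ≤ |h| * B := by
    rw [abs_mul, hBdef, ← hPE.energy_eq t]
    gcongr
    exact abs_snd_le_energy _ _
  have hfst := mul_le_mul_of_nonneg_left (neg_le_of_abs_le (hPE_le t)) hh0.le
  have hsnd := mul_le_mul_of_nonneg_left (neg_le_of_abs_le hE_le)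
    (by positivity : 0 ≤ (1 + B) * B)
  linarith

theorem IsVariation.linearizedEnergy_eq (hab : IsVariation P a b) (hPE : IsOscillation P E)
    (t : ℝ) : linearizedEnergy (P t) (E t) (a t) (b t) =
      linearizedEnergy (P 0) (E 0) (a 0) (b 0) := by
  have hderiv (t : ℝ) :
      HasDerivAt (fun t => linearizedEnergy (P t) (E t) (a t) (b t)) 0 t := by
    refine ((((hasDerivAt_velocity (P t)).comp t (hPE.hasDerivAt_fst t)).mul
      (hab.hasDerivAt_fst t)).add
      ((hPE.hasDerivAt_snd t).mul (hab.hasDerivAt_snd t))).congr_deriv ?_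
    simp only [Function.comp_apply]
    ring
  exact is_const_of_deriv_eq_zero (fun t => (hderiv t).differentiableAt)
    (fun t => (hderiv t).deriv) t 0

theorem IsVariation.hasDerivAt_phaseShift (hab : IsVariation P a b) (hPE : IsOscillation P E)
    {t : ℝ} (hD : arealVelocity (P t) (E t) ≠ 0) :
    HasDerivAt (fun t => phaseShift (P t) (E t) (a t) (b t))
      (-(linearizedEnergy (P t) (E t) (a t) (b t) * (velocity (P t) ^ 3 * P t)) /
        arealVelocity (P t) (E t) ^ 2) t := by
  have hP := hPE.hasDerivAt_fst t
  have hE := hPE.hasDerivAt_snd t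
  have hnum := ((hab.hasDerivAt_snd t).mul hP).sub ((hab.hasDerivAt_fst t).mul hE)
  have hden := (hP.mul ((hasDerivAt_velocity (P t)).comp t hP)).add (hE.pow 2)
  refine (hnum.div hden hD).congr_deriv ?_
  simp only [Function.comp_apply, Pi.mul_apply, Pi.sub_apply, Pi.add_apply, Pi.pow_apply,
    linearizedEnergy, arealVelocity]
  congr 1
  push_cast
  linear_combination (a t * (P t * velocity (P t) + E t ^ 2)
    + (b t * P t - a t * E t) * E t) * velocityDeriv_mul_self (P t)

theorem mul_velocity_sub_sq_le {p e : ℝ} (h : 2 < energy p e) :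
    p * velocity p - e ^ 2 ≤ -(energy p e / 2 - 1) +
      (1 + energy p e / 2) ^ 2 * (energy p e / 2) / (4 * (energy p e / 2 - 1)) *
        (velocity p ^ 3 * p) := by
  have hlow := energy_sub_two_le p e
  have hsq := sq_mul_velocity_le (sqrt_one_add_sq_le_energy p e)
  set B := energy p e / 2 with hBdef
  set x := p * velocity p
  have hB : 0 < B - 1 := by linarith
  have amgm : (1 + B) * x ≤ (B - 1) + ((1 + B) * x) ^ 2 / (4 * (B - 1)) := by
    rw [← sub_le_iff_le_add', le_div_iff₀ (by positivity)]
    linarith [sq_nonneg ((1 + B) * x - 2 * (B - 1))]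
  have hdiv : ((1 + B) * x) ^ 2 / (4 * (B - 1)) ≤
      (1 + B) ^ 2 * B / (4 * (B - 1)) * (velocity p ^ 3 * p) := by
    rw [mul_pow, div_mul_eq_mul_div, mul_assoc]
    gcongr
  linarith

theorem mul_sq_div_sq_mul_neg_div_sq_le {A D h L w : ℝ} (hh : h ≠ 0) (hD : 0 < D) (hDA : D ≤ A)
    (hLw : 0 ≤ L * w) : L * A ^ 2 / h ^ 2 * (h * (-(h * w) / D ^ 2)) ≤ -(L * w) := by
  have hratio : 1 ≤ A ^ 2 / D ^ 2 := by
    rw [one_le_div (by positivity)]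
    gcongr
  calc L * A ^ 2 / h ^ 2 * (h * (-(h * w) / D ^ 2)) = -(L * w * (A ^ 2 / D ^ 2)) := by
        field_simp
    _ ≤ -(L * w) := neg_le_neg (le_mul_of_one_le_right hLw hratio)

theorem IsVariation.tendsto_mul_phaseShift_atBot (hab : IsVariation P a b)
    (hPE : IsOscillation P E) {h : ℝ} (hh : h ≠ 0)
    (hlin : linearizedEnergy (P 0) (E 0) (a 0) (b 0) = h) :
    Tendsto (fun t => h * phaseShift (P t) (E t) (a t) (b t)) atTop atBot := by
  have hen : 2 < energy (P 0) (E 0) :=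
    two_lt_energy_of_linearizedEnergy_ne_zero (hlin.trans_ne hh)
  have henergy := hPE.energy_eq
  have hPE_le := hPE.abs_mul_le
  set B := energy (P 0) (E 0) / 2 with hBdef
  have hB : 1 < B := by linarith
  set L := (1 + B) ^ 2 * B / (4 * (B - 1))
  have hL0 : 0 < L := div_pos (by positivity) (by linarith)
  set K := L * (B + B ^ 2) ^ 2 / h ^ 2
  have hK0 : 0 < K := by positivity
  have hareal (t : ℝ) : 0 < arealVelocity (P t) (E t) := arealVelocity_pos (by rwa [henergy])
  have hvirial : Tendsto
      (fun t => P t * E t + K * (h * phaseShift (P t) (E t) (a t) (b t))) atTop atBot := by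
    refine tendsto_atBot_of_hasDerivAt_le (sub_pos.2 hB) (fun t => (hPE.hasDerivAt_mul t).add
      (((hab.hasDerivAt_phaseShift hPE (hareal t).ne').const_mul h).const_mul K))
      (Eventually.of_forall fun t => ?_)
    rw [hab.linearizedEnergy_eq hPE, hlin]
    have hle := mul_velocity_sub_sq_le (p := P t) (e := E t) (by rwa [henergy])
    have hareal_le := arealVelocity_le (P t) (E t)
    rw [henergy, ← hBdef] at hle hareal_le
    have hw : 0 ≤ velocity (P t) ^ 3 * P t := velocity_pow_three_mul_nonneg (P t)
    set w := velocity (P t) ^ 3 * P t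
    set D := arealVelocity (P t) (E t)
    have hdrift : K * (h * (-(h * w) / D ^ 2)) ≤ -(L * w) :=
      mul_sq_div_sq_mul_neg_div_sq_le hh (hareal t) hareal_le (mul_nonneg hL0.le hw)
    linarith
  have hbound (t : ℝ) : K * (h * phaseShift (P t) (E t) (a t) (b t)) ≤
      P t * E t + K * (h * phaseShift (P t) (E t) (a t) (b t)) + B ^ 2 := by
    linarith [neg_le_of_abs_le (hPE_le t)]
  exact (tendsto_const_mul_atBot_of_pos hK0).1
    (tendsto_atBot_mono hbound (tendsto_atBot_add_const_right _ _ hvirial))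

theorem IsVariation.frequently_le (hab : IsVariation P a b) (hPE : IsOscillation P E)
    (h0 : linearizedEnergy (P 0) (E 0) (a 0) (b 0) ≠ 0) (M : ℝ) : ∃ᶠ t in atTop, b t ≤ M := by
  obtain ⟨h, hlin⟩ : ∃ h, linearizedEnergy (P 0) (E 0) (a 0) (b 0) = h := ⟨_, rfl⟩
  have hen : 2 < energy (P 0) (E 0) := two_lt_energy_of_linearizedEnergy_ne_zero h0
  have hh : h ≠ 0 := hlin ▸ h0
  have hareal (t : ℝ) : 0 < arealVelocity (P t) (E t) :=
    arealVelocity_pos (by rwa [hPE.energy_eq])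
  obtain ⟨C, hC⟩ := hPE.exists_forall_abs_div_arealVelocity_le hen
  obtain ⟨κ, hκ, hfreq⟩ := hPE.exists_frequently_le_mul_velocity hen hh
  have hphase := (hab.tendsto_mul_phaseShift_atBot hPE hh hlin).eventually_le_atBot
    (-(h ^ 2 * (|h| * C + |M|) / κ))
  refine (hfreq.and_eventually hphase).mono fun t ⟨hV, hα⟩ => ?_
  set α := phaseShift (P t) (E t) (a t) (b t)
  have hb : b t = α * velocity (P t) + h * (E t / arealVelocity (P t) (E t)) := by
    rw [← hlin, ← hab.linearizedEnergy_eq hPE t, ← mul_div_assoc]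
    exact eq_phaseShift_mul_velocity_add (hareal t).ne' _ _
  have hnormal : h * (E t / arealVelocity (P t) (E t)) ≤ |h| * C := by
    refine (le_abs_self _).trans ?_
    rw [abs_mul]
    exact mul_le_mul_of_nonneg_left (hC t) (abs_nonneg h)
  have htangent : α * velocity (P t) ≤ -(|h| * C + |M|) := by
    have hC0 : 0 ≤ C := (abs_nonneg _).trans (hC 0)
    have hN : 0 ≤ h ^ 2 * (|h| * C + |M|) / κ := by positivity
    refine le_of_mul_le_mul_left ?_ (by positivity : 0 < h ^ 2)
    calc h ^ 2 * (α * velocity (P t)) = (h * α) * (h * velocity (P t)) := by ring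
      _ ≤ -(h ^ 2 * (|h| * C + |M|) / κ) * κ := by nlinarith
      _ = h ^ 2 * -(|h| * C + |M|) := by
        field_simp
  linarith [neg_abs_le M]

end Oscillation

section Characteristics

/-- The vector field of the equations `P' = -E`, `E' = V(P)` together with their linearization
`a' = -b`, `b' = V'(P) a`, at the point `((P, E), (a, b))`. -/
noncomputable def tangentField (x : (ℝ × ℝ) × (ℝ × ℝ)) : (ℝ × ℝ) × (ℝ × ℝ) :=
  ((-x.1.2, velocity x.1.1), (-x.2.2, velocityDeriv x.1.1 * x.2.1))

theorem contDiff_tangentField : ContDiff ℝ 1 tangentField := by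
  have hV : ContDiff ℝ 1 velocity := contDiff_velocity
  have hV' : ContDiff ℝ 1 velocityDeriv := contDiff_velocityDeriv
  unfold tangentField
  fun_prop

theorem norm_neg_velocityDeriv_mul_le (p : ℝ) (x : ℝ × ℝ) :
    ‖(-x.2, velocityDeriv p * x.1)‖ ≤ ‖x‖ := by
  rw [Prod.norm_mk, norm_neg, norm_mul, max_comm]
  exact max_le_max_right _ (mul_le_of_le_one_left (norm_nonneg _) (abs_velocityDeriv_le_one p))

theorem norm_tangentField_le (x : (ℝ × ℝ) × (ℝ × ℝ)) :
    ‖tangentField x‖ ≤ (1 : ℝ≥0) * ‖x‖ + (1 : ℝ≥0) := by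
  rw [NNReal.coe_one, one_mul, tangentField, Prod.norm_mk]
  refine max_le ?_ ((norm_neg_velocityDeriv_mul_le _ _).trans ?_)
  · rw [Prod.norm_mk, norm_neg]
    exact max_le ((norm_snd_le x.1).trans ((norm_fst_le x).trans (by simp)))
      ((abs_velocity_le_one _).trans (by simp))
  · exact (norm_snd_le x).trans (by simp)

theorem exists_isIntegralCurve_tangentField (x : (ℝ × ℝ) × (ℝ × ℝ)) :
    ∃ γ : ℝ → (ℝ × ℝ) × (ℝ × ℝ), γ 0 = x ∧ IsIntegralCurve γ fun _ => tangentField :=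
  exists_isIntegralCurve_of_norm_le contDiff_tangentField norm_tangentField_le x

/-- The flow of `tangentField`. -/
noncomputable def tangentFlow (x : (ℝ × ℝ) × (ℝ × ℝ)) : ℝ → (ℝ × ℝ) × (ℝ × ℝ) :=
  (exists_isIntegralCurve_tangentField x).choose

theorem tangentFlow_zero (x : (ℝ × ℝ) × (ℝ × ℝ)) : tangentFlow x 0 = x :=
  (exists_isIntegralCurve_tangentField x).choose_spec.1

theorem isIntegralCurve_tangentFlow (x : (ℝ × ℝ) × (ℝ × ℝ)) :
    IsIntegralCurve (tangentFlow x) fun _ => tangentField :=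
  (exists_isIntegralCurve_tangentField x).choose_spec.2

theorem continuous_tangentFlow :
    Continuous fun q : ((ℝ × ℝ) × (ℝ × ℝ)) × ℝ => tangentFlow q.1 q.2 :=
  continuous_of_forall_isIntegralCurve contDiff_tangentField norm_tangentField_le
    tangentFlow_zero isIntegralCurve_tangentFlow

/-- The state `((P, E), (∂P/∂x, ∂E/∂x))` at time `t` on the characteristic of the Cauchy problem
with data `P₀`, `E₀` that starts at the point `x`. -/
noncomputable def lagrangian (P₀ E₀ : ℝ → ℝ) (x t : ℝ) : (ℝ × ℝ) × (ℝ × ℝ) :=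
  tangentFlow ((P₀ x, E₀ x), (deriv P₀ x, deriv E₀ x)) t

/-- The momentum at time `t` on the characteristic starting at `x`. -/
noncomputable def charP (P₀ E₀ : ℝ → ℝ) (x t : ℝ) : ℝ := (lagrangian P₀ E₀ x t).1.1

/-- The electric field at time `t` on the characteristic starting at `x`. -/
noncomputable def charE (P₀ E₀ : ℝ → ℝ) (x t : ℝ) : ℝ := (lagrangian P₀ E₀ x t).1.2

/-- The derivative of `charP` with respect to the starting point. -/
noncomputable def charDP (P₀ E₀ : ℝ → ℝ) (x t : ℝ) : ℝ := (lagrangian P₀ E₀ x t).2.1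

/-- The derivative of `charE` with respect to the starting point. -/
noncomputable def charDE (P₀ E₀ : ℝ → ℝ) (x t : ℝ) : ℝ := (lagrangian P₀ E₀ x t).2.2

/-- The position at time `t` of the characteristic starting at `x`. It moves with velocity `V`,
which is also the derivative of `E` along it, so that `charX - charE` does not depend on time. -/
noncomputable def charX (P₀ E₀ : ℝ → ℝ) (x t : ℝ) : ℝ := x - E₀ x + charE P₀ E₀ x t

/-- The derivative of `charX` with respect to the starting point. -/
noncomputable def charJ (P₀ E₀ : ℝ → ℝ) (x t : ℝ) : ℝ := 1 - deriv E₀ x + charDE P₀ E₀ x t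

variable {P₀ E₀ : ℝ → ℝ}

theorem charP_zero (x : ℝ) : charP P₀ E₀ x 0 = P₀ x := by
  simp [charP, lagrangian, tangentFlow_zero]

theorem charE_zero (x : ℝ) : charE P₀ E₀ x 0 = E₀ x := by
  simp [charE, lagrangian, tangentFlow_zero]

theorem charDP_zero (x : ℝ) : charDP P₀ E₀ x 0 = deriv P₀ x := by
  simp [charDP, lagrangian, tangentFlow_zero]

theorem charDE_zero (x : ℝ) : charDE P₀ E₀ x 0 = deriv E₀ x := by
  simp [charDE, lagrangian, tangentFlow_zero]

theorem charX_zero (x : ℝ) : charX P₀ E₀ x 0 = x := by simp [charX, charE_zero]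

theorem charJ_zero (x : ℝ) : charJ P₀ E₀ x 0 = 1 := by simp [charJ, charDE_zero]

theorem isOscillation_char (x : ℝ) : IsOscillation (charP P₀ E₀ x) (charE P₀ E₀ x) where
  hasDerivAt_fst t := (isIntegralCurve_tangentFlow _ t).fst.fst
  hasDerivAt_snd t := (isIntegralCurve_tangentFlow _ t).fst.snd

theorem isVariation_charD (x : ℝ) :
    IsVariation (charP P₀ E₀ x) (charDP P₀ E₀ x) (charDE P₀ E₀ x) where
  hasDerivAt_fst t := (isIntegralCurve_tangentFlow _ t).snd.fst
  hasDerivAt_snd t := (isIntegralCurve_tangentFlow _ t).snd.snd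

theorem hasDerivAt_charX_time (x t : ℝ) :
    HasDerivAt (charX P₀ E₀ x) (velocity (charP P₀ E₀ x t)) t :=
  ((isOscillation_char x).hasDerivAt_snd t).const_add _

theorem continuous_charX_time (x : ℝ) : Continuous (charX P₀ E₀ x) :=
  continuous_iff_continuousAt.2 fun t => (hasDerivAt_charX_time x t).continuousAt

theorem hasDerivAt_charJ (x t : ℝ) :
    HasDerivAt (charJ P₀ E₀ x) (velocityDeriv (charP P₀ E₀ x t) * charDP P₀ E₀ x t) t :=
  ((isVariation_charD x).hasDerivAt_snd t).const_add _

theorem abs_charX_sub_le (x t : ℝ) : |charX P₀ E₀ x t - x| ≤ |t| := by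
  simpa [charX_zero] using convex_univ.norm_image_sub_le_of_norm_hasDerivWithin_le
    (fun s _ => (hasDerivAt_charX_time (P₀ := P₀) (E₀ := E₀) x s).hasDerivWithinAt)
    (fun s _ => abs_velocity_le_one _) (mem_univ 0) (mem_univ t)

theorem norm_charD_le (x s t : ℝ) :
    ‖(charDP P₀ E₀ x t, charDE P₀ E₀ x t)‖ ≤
      ‖(charDP P₀ E₀ x s, charDE P₀ E₀ x s)‖ * Real.exp |t - s| := by
  simpa only [one_mul] using norm_le_norm_mul_exp
    (f := fun t => (charDP P₀ E₀ x t, charDE P₀ E₀ x t)) (K := 1)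
    (fun t => ((isVariation_charD x).hasDerivAt_fst t).prodMk
      ((isVariation_charD x).hasDerivAt_snd t))
    (fun t => (norm_neg_velocityDeriv_mul_le _ _).trans_eq (one_mul _).symm) s t

theorem one_sub_charJ_le (x t : ℝ) :
    1 - charJ P₀ E₀ x t ≤ 2 * Real.exp |t| * ‖(charDP P₀ E₀ x t, charDE P₀ E₀ x t)‖ := by
  have hinit : deriv E₀ x ≤ ‖(charDP P₀ E₀ x t, charDE P₀ E₀ x t)‖ * Real.exp |t| := by
    have h := (norm_snd_le _).trans (norm_charD_le (P₀ := P₀) (E₀ := E₀) x t 0)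
    rw [charDE_zero, zero_sub, abs_neg] at h
    exact (le_abs_self _).trans h
  have hcurrent : -charDE P₀ E₀ x t ≤ ‖(charDP P₀ E₀ x t, charDE P₀ E₀ x t)‖ :=
    (neg_le_abs _).trans (norm_snd_le (charDP P₀ E₀ x t, charDE P₀ E₀ x t))
  have hexp := mul_le_mul_of_nonneg_left (Real.one_le_exp (abs_nonneg t))
    (norm_nonneg (charDP P₀ E₀ x t, charDE P₀ E₀ x t))
  unfold charJ
  linarith

/-- The derivative of the vector field `(P, E) ↦ (-E, V(P))` at a point with momentum `p`. -/
noncomputable def oscillationFieldDeriv (p : ℝ) : ℝ × ℝ →L[ℝ] ℝ × ℝ :=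
  (-ContinuousLinearMap.snd ℝ ℝ ℝ).prod (velocityDeriv p • ContinuousLinearMap.fst ℝ ℝ ℝ)

theorem hasFDerivAt_neg_snd_velocity_fst (z : ℝ × ℝ) :
    HasFDerivAt (fun z : ℝ × ℝ => (-z.2, velocity z.1)) (oscillationFieldDeriv z.1) z :=
  hasFDerivAt_snd.neg.prodMk ((hasDerivAt_velocity z.1).comp_hasFDerivAt z hasFDerivAt_fst)

theorem norm_oscillationFieldDeriv_le_one (p : ℝ) : ‖oscillationFieldDeriv p‖ ≤ 1 :=
  ContinuousLinearMap.opNorm_le_bound _ zero_le_one fun w => by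
    simpa [oscillationFieldDeriv] using norm_neg_velocityDeriv_mul_le p w

theorem lipschitzWith_oscillationFieldDeriv : LipschitzWith 3 oscillationFieldDeriv := by
  refine LipschitzWith.of_dist_le_mul fun p q => ?_
  rw [dist_eq_norm, dist_eq_norm]
  refine ContinuousLinearMap.opNorm_le_bound _ (by positivity) fun w => ?_
  have hw := mul_le_mul (lipschitzWith_velocityDeriv.norm_sub_le p q) (norm_fst_le w)
    (norm_nonneg _) (by positivity)
  simpa [oscillationFieldDeriv, ← sub_mul, Prod.norm_mk] using And.intro (by positivity) hw

theorem hasDerivAt_char_space {x : ℝ} (hP : DifferentiableAt ℝ P₀ x)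
    (hE : DifferentiableAt ℝ E₀ x) (t : ℝ) :
    HasDerivAt (fun y => (charP P₀ E₀ y t, charE P₀ E₀ y t))
      (charDP P₀ E₀ x t, charDE P₀ E₀ x t) x := by
  have hlip : LipschitzWith 3 fun z : ℝ × ℝ => oscillationFieldDeriv z.1 := by
    simpa [Function.comp_def] using lipschitzWith_oscillationFieldDeriv.comp LipschitzWith.prod_fst
  refine hasDerivAt_of_hasDerivAt_zero (K := 1) hasFDerivAt_neg_snd_velocity_fst
    (fun z => norm_oscillationFieldDeriv_le_one z.1) hlip
    (γ := fun y t => (charP P₀ E₀ y t, charE P₀ E₀ y t))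
    (w := fun t => (charDP P₀ E₀ x t, charDE P₀ E₀ x t))
    (fun y t => ((isOscillation_char y).hasDerivAt_fst t).prodMk
      ((isOscillation_char y).hasDerivAt_snd t))
    (fun t => ((isVariation_charD x).hasDerivAt_fst t).prodMk
      ((isVariation_charD x).hasDerivAt_snd t)) ?_ t
  simpa only [charP_zero, charE_zero, charDP_zero, charDE_zero] using
    hP.hasDerivAt.prodMk hE.hasDerivAt

theorem hasDerivAt_charX_space {x : ℝ} (hP : DifferentiableAt ℝ P₀ x)
    (hE : DifferentiableAt ℝ E₀ x) (t : ℝ) :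
    HasDerivAt (fun y => charX P₀ E₀ y t) (charJ P₀ E₀ x t) x :=
  ((hasDerivAt_id x).sub hE.hasDerivAt).add (hasDerivAt_char_space hP hE t).snd

theorem charX_surjective (hP : Differentiable ℝ P₀) (hE : Differentiable ℝ E₀) (t : ℝ) :
    Function.Surjective fun x => charX P₀ E₀ x t := by
  have hcont : Continuous fun x => charX P₀ E₀ x t := continuous_iff_continuousAt.2 fun x =>
    (hasDerivAt_charX_space (hP x) (hE x) t).continuousAt
  have hbound (x : ℝ) := abs_le.1 (abs_charX_sub_le (P₀ := P₀) (E₀ := E₀) x t)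
  exact hcont.surjective
    (tendsto_atTop_mono (f := fun x => x + -|t|) (fun x => by linarith [(hbound x).1])
      (tendsto_atTop_add_const_right _ (-|t|) tendsto_id))
    (tendsto_atBot_mono (f := fun x => x + |t|) (fun x => by linarith [(hbound x).2])
      (tendsto_atBot_add_const_right _ |t| tendsto_id))

end Characteristics

section Regularity

variable {f f₁ f₂ : ℝ → ℝ → ℝ}

theorem hasFDerivAt_of_continuous_partials (h₁ : ∀ x t, HasDerivAt (fun y => f y t) (f₁ x t) x)
    (h₂ : ∀ x t, HasDerivAt (f x) (f₂ x t) t) (c₁ : Continuous fun q : ℝ × ℝ => f₁ q.1 q.2)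
    (c₂ : Continuous fun q : ℝ × ℝ => f₂ q.1 q.2) (q : ℝ × ℝ) :
    HasFDerivAt (fun q : ℝ × ℝ => f q.1 q.2)
      (f₁ q.1 q.2 • ContinuousLinearMap.fst ℝ ℝ ℝ + f₂ q.1 q.2 • ContinuousLinearMap.snd ℝ ℝ ℝ)
      q := by
  have h := hasStrictFDerivAt_uncurry_coprod (𝕜 := ℝ) (u := q) (f := f)
    (f₁ := fun x t => ContinuousLinearMap.toSpanSingleton ℝ (f₁ x t))
    (f₂ := fun x t => ContinuousLinearMap.toSpanSingleton ℝ (f₂ x t))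
    (.of_forall fun v => (h₁ v.1 v.2).hasFDerivAt) (.of_forall fun v => (h₂ v.1 v.2).hasFDerivAt)
    (ContinuousLinearMap.toSpanSingletonCLE.continuous.comp c₁).continuousAt
    (ContinuousLinearMap.toSpanSingletonCLE.continuous.comp c₂).continuousAt
  refine h.hasFDerivAt.congr_fderiv ?_
  ext <;> simp [Function.HasUncurry.uncurry]

theorem contDiff_one_of_continuous_partials
    (h₁ : ∀ x t, HasDerivAt (fun y => f y t) (f₁ x t) x)
    (h₂ : ∀ x t, HasDerivAt (f x) (f₂ x t) t) (c₁ : Continuous fun q : ℝ × ℝ => f₁ q.1 q.2)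
    (c₂ : Continuous fun q : ℝ × ℝ => f₂ q.1 q.2) :
    ContDiff ℝ 1 fun q : ℝ × ℝ => f q.1 q.2 :=
  contDiff_one_iff_hasFDerivAt.2 ⟨_, by fun_prop, hasFDerivAt_of_continuous_partials h₁ h₂ c₁ c₂⟩

variable {P₀ E₀ : ℝ → ℝ} (hP : ContDiff ℝ 1 P₀) (hE : ContDiff ℝ 1 E₀)
include hP hE

theorem continuous_lagrangian : Continuous fun q : ℝ × ℝ => lagrangian P₀ E₀ q.1 q.2 := by
  have := hP.continuous_deriv le_rfl
  have := hE.continuous_deriv le_rfl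
  exact continuous_tangentFlow.comp (f := fun q : ℝ × ℝ =>
    (((P₀ q.1, E₀ q.1), (deriv P₀ q.1, deriv E₀ q.1)), q.2)) (by fun_prop)

theorem continuous_velocity_charP : Continuous fun q : ℝ × ℝ => velocity (charP P₀ E₀ q.1 q.2) :=
  (contDiff_velocity (n := 0)).continuous.comp (continuous_lagrangian hP hE).fst.fst

theorem continuous_charJ : Continuous fun q : ℝ × ℝ => charJ P₀ E₀ q.1 q.2 :=
  (continuous_const.sub ((hE.continuous_deriv le_rfl).comp continuous_fst)).add
    (continuous_lagrangian hP hE).snd.snd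

theorem contDiff_charP : ContDiff ℝ 1 fun q : ℝ × ℝ => charP P₀ E₀ q.1 q.2 :=
  contDiff_one_of_continuous_partials
    (fun x t => (hasDerivAt_char_space (hP.differentiable one_ne_zero x)
      (hE.differentiable one_ne_zero x) t).fst)
    (fun x => (isOscillation_char x).hasDerivAt_fst)
    (continuous_lagrangian hP hE).snd.fst (continuous_lagrangian hP hE).fst.snd.neg

theorem contDiff_charE : ContDiff ℝ 1 fun q : ℝ × ℝ => charE P₀ E₀ q.1 q.2 :=
  contDiff_one_of_continuous_partials
    (fun x t => (hasDerivAt_char_space (hP.differentiable one_ne_zero x)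
      (hE.differentiable one_ne_zero x) t).snd)
    (fun x => (isOscillation_char x).hasDerivAt_snd)
    (continuous_lagrangian hP hE).snd.snd (continuous_velocity_charP hP hE)

theorem contDiff_charX : ContDiff ℝ 1 fun q : ℝ × ℝ => charX P₀ E₀ q.1 q.2 :=
  ((contDiff_id.sub hE).comp contDiff_fst).add (contDiff_charE hP hE)

theorem hasFDerivAt_charX (q : ℝ × ℝ) :
    HasFDerivAt (fun q : ℝ × ℝ => charX P₀ E₀ q.1 q.2)
      (charJ P₀ E₀ q.1 q.2 • ContinuousLinearMap.fst ℝ ℝ ℝ +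
        velocity (charP P₀ E₀ q.1 q.2) • ContinuousLinearMap.snd ℝ ℝ ℝ) q :=
  hasFDerivAt_of_continuous_partials
    (fun x => hasDerivAt_charX_space (hP.differentiable one_ne_zero x)
      (hE.differentiable one_ne_zero x)) hasDerivAt_charX_time
    (continuous_charJ hP hE) (continuous_velocity_charP hP hE) q

end Regularity

section Strip

variable {Q : ℝ × ℝ → ℝ} {c : ℝ → ℝ} {T t : ℝ}

theorem strip_mem_nhds (ht : t ∈ Ioo 0 T) (ρ : ℝ) : (univ : Set ℝ) ×ˢ Ico 0 T ∈ 𝓝 (ρ, t) :=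
  prod_mem_nhds univ_mem (Ico_mem_nhds ht.1 ht.2)

theorem differentiableAt_of_contDiffOn_strip (hQ : ContDiffOn ℝ 1 Q (univ ×ˢ Ico 0 T))
    (ht : t ∈ Ioo 0 T) (ρ : ℝ) : DifferentiableAt ℝ Q (ρ, t) :=
  (hQ.contDiffAt (strip_mem_nhds ht ρ)).differentiableAt one_ne_zero

theorem hasDerivAt_left_of_hasFDerivAt {Q' : ℝ × ℝ →L[ℝ] ℝ} {ρ : ℝ}
    (hQ : HasFDerivAt Q Q' (ρ, t)) : HasDerivAt (fun r => Q (r, t)) (Q' (1, 0)) ρ :=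
  hQ.comp_hasDerivAt ρ ((hasDerivAt_id ρ).prodMk (hasDerivAt_const ρ t))

theorem hasDerivAt_right_of_hasFDerivAt {Q' : ℝ × ℝ →L[ℝ] ℝ} {ρ : ℝ}
    (hQ : HasFDerivAt Q Q' (ρ, t)) : HasDerivAt (fun s => Q (ρ, s)) (Q' (0, 1)) t :=
  hQ.comp_hasDerivAt t ((hasDerivAt_const t ρ).prodMk (hasDerivAt_id t))

theorem hasDerivAt_comp_curve {c' : ℝ} (hQ : DifferentiableAt ℝ Q (c t, t))
    (hc : HasDerivAt c c' t) :
    HasDerivAt (fun s => Q (c s, s))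
      (deriv (fun s => Q (c t, s)) t + c' * deriv (fun r => Q (r, t)) (c t)) t := by
  rw [(hasDerivAt_left_of_hasFDerivAt hQ.hasFDerivAt).deriv,
    (hasDerivAt_right_of_hasFDerivAt hQ.hasFDerivAt).deriv, ← smul_eq_mul, ← map_smul, ← map_add]
  refine (HasFDerivAt.comp_hasDerivAt (f := fun s => (c s, s)) t hQ.hasFDerivAt
    (hc.prodMk (hasDerivAt_id t))).congr_deriv ?_
  simp

theorem continuousOn_comp_curve {X : Type*} [TopologicalSpace X] {g : ℝ × ℝ → X} {s : Set ℝ}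
    (hg : ContinuousOn g (univ ×ˢ s)) (hc : Continuous c) :
    ContinuousOn (fun r => g (c r, r)) s :=
  hg.comp (by fun_prop) fun _ hr => ⟨mem_univ _, hr⟩

theorem exists_abs_deriv_comp_curve_le (hQ : ContDiffOn ℝ 1 Q (univ ×ˢ Ico 0 T))
    (hc : Continuous c) (ht : t < T) :
    ∃ C, ∀ s ∈ Ioc 0 t, |deriv (fun r => Q (r, s)) (c s)| ≤ C := by
  have hunique : UniqueDiffOn ℝ ((univ : Set ℝ) ×ˢ Ico 0 T) :=
    uniqueDiffOn_univ.prod (uniqueDiffOn_Ico 0 T)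
  have hcont : ContinuousOn (fun s => fderivWithin ℝ Q (univ ×ˢ Ico 0 T) (c s, s)) (Icc 0 t) :=
    (continuousOn_comp_curve (hQ.continuousOn_fderivWithin hunique le_rfl) hc).mono
      (Icc_subset_Ico_right ht)
  obtain ⟨C, hC⟩ := isCompact_Icc.exists_bound_of_continuousOn hcont
  refine ⟨C, fun s hs => ?_⟩
  have hs' : s ∈ Ioo 0 T := ⟨hs.1, hs.2.trans_lt ht⟩
  have hCs := hC s ⟨hs.1.le, hs.2⟩
  rw [fderivWithin_of_mem_nhds (strip_mem_nhds hs' _)] at hCs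
  rw [(hasDerivAt_left_of_hasFDerivAt
    (differentiableAt_of_contDiffOn_strip hQ hs' _).hasFDerivAt).deriv]
  simpa [Prod.norm_mk] using ContinuousLinearMap.le_of_opNorm_le _ hCs (1, 0)

end Strip

section Uniqueness

variable {P₀ E₀ : ℝ → ℝ} {T t : ℝ} {Q F : ℝ × ℝ → ℝ}

theorem IsC1Solution.hasDerivAt_fst_comp_curve (h : IsC1Solution P₀ E₀ T Q F) (ht : t ∈ Ioo 0 T)
    {c : ℝ → ℝ} {c' : ℝ} (hc : HasDerivAt c c' t) :
    HasDerivAt (fun s => Q (c s, s))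
      (-F (c t, t) - (velocity (Q (c t, t)) - c') * deriv (fun r => Q (r, t)) (c t)) t := by
  refine (hasDerivAt_comp_curve (differentiableAt_of_contDiffOn_strip h.contDiffOn_P ht _)
    hc).congr_deriv ?_
  linear_combination h.eq_P (c t) t ht

theorem IsC1Solution.hasDerivAt_snd_comp_curve (h : IsC1Solution P₀ E₀ T Q F) (ht : t ∈ Ioo 0 T)
    {c : ℝ → ℝ} {c' : ℝ} (hc : HasDerivAt c c' t) :
    HasDerivAt (fun s => F (c s, s))
      (velocity (Q (c t, t)) -
        (velocity (Q (c t, t)) - c') * deriv (fun r => F (r, t)) (c t)) t := by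
  refine (hasDerivAt_comp_curve (differentiableAt_of_contDiffOn_strip h.contDiffOn_E ht _)
    hc).congr_deriv ?_
  linear_combination h.eq_E (c t) t ht

theorem norm_neg_sub_mul_prodMk_le {p e v x y C : ℝ} (hv : |v| ≤ |p|) (hx : |x| ≤ C)
    (hy : |y| ≤ C) : ‖(-e - v * x, v - v * y)‖ ≤ (1 + C) * ‖(p, e)‖ := by
  have hp : |p| ≤ ‖(p, e)‖ := norm_fst_le (p, e)
  have he : |e| ≤ ‖(p, e)‖ := norm_snd_le (p, e)
  have hmul {z : ℝ} (hz : |z| ≤ C) : |v * z| ≤ ‖(p, e)‖ * C := by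
    rw [abs_mul]
    exact mul_le_mul (hv.trans hp) hz (abs_nonneg z) (norm_nonneg _)
  rw [Prod.norm_mk, Real.norm_eq_abs, Real.norm_eq_abs]
  refine max_le ((abs_sub _ _).trans ?_) ((abs_sub _ _).trans ?_)
  · rw [abs_neg]
    linarith [hmul hx]
  · linarith [hmul hy]

theorem IsC1Solution.hasDerivAt_sub_char (h : IsC1Solution P₀ E₀ T Q F) (x : ℝ)
    (ht : t ∈ Ioo 0 T) :
    HasDerivAt (fun s => (Q (charX P₀ E₀ x s, s) - charP P₀ E₀ x s,
        F (charX P₀ E₀ x s, s) - charE P₀ E₀ x s))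
      (-(F (charX P₀ E₀ x t, t) - charE P₀ E₀ x t) -
          (velocity (Q (charX P₀ E₀ x t, t)) - velocity (charP P₀ E₀ x t)) *
            deriv (fun r => Q (r, t)) (charX P₀ E₀ x t),
        velocity (Q (charX P₀ E₀ x t, t)) - velocity (charP P₀ E₀ x t) -
          (velocity (Q (charX P₀ E₀ x t, t)) - velocity (charP P₀ E₀ x t)) *
            deriv (fun r => F (r, t)) (charX P₀ E₀ x t)) t :=
  have hX := hasDerivAt_charX_time (P₀ := P₀) (E₀ := E₀) x t
  (((h.hasDerivAt_fst_comp_curve ht hX).sub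
    ((isOscillation_char x).hasDerivAt_fst t)).congr_deriv (by ring)).prodMk
    (((h.hasDerivAt_snd_comp_curve ht hX).sub
      ((isOscillation_char x).hasDerivAt_snd t)).congr_deriv (by ring))

theorem IsC1Solution.continuousOn_sub_char (h : IsC1Solution P₀ E₀ T Q F) (x : ℝ) :
    ContinuousOn (fun s => (Q (charX P₀ E₀ x s, s) - charP P₀ E₀ x s,
      F (charX P₀ E₀ x s, s) - charE P₀ E₀ x s)) (Ico 0 T) :=
  ((continuousOn_comp_curve h.contDiffOn_P.continuousOn (continuous_charX_time x)).sub
    (HasDerivAt.continuousOn fun s _ => (isOscillation_char x).hasDerivAt_fst s)).prodMk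
    ((continuousOn_comp_curve h.contDiffOn_E.continuousOn (continuous_charX_time x)).sub
      (HasDerivAt.continuousOn fun s _ => (isOscillation_char x).hasDerivAt_snd s))

theorem IsC1Solution.prodMk_eq_char (h : IsC1Solution P₀ E₀ T Q F) (x : ℝ) (ht : t ∈ Ico 0 T) :
    (Q (charX P₀ E₀ x t, t), F (charX P₀ E₀ x t, t)) = (charP P₀ E₀ x t, charE P₀ E₀ x t) := by
  obtain ⟨τ, htτ, hτT⟩ := exists_between ht.2
  obtain ⟨C₁, hC₁⟩ := exists_abs_deriv_comp_curve_le h.contDiffOn_P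
    (continuous_charX_time (P₀ := P₀) (E₀ := E₀) x) hτT
  obtain ⟨C₂, hC₂⟩ := exists_abs_deriv_comp_curve_le h.contDiffOn_E
    (continuous_charX_time (P₀ := P₀) (E₀ := E₀) x) hτT
  have hbound (s : ℝ) (hs : s ∈ Ioo 0 τ) :=
    norm_neg_sub_mul_prodMk_le (e := F (charX P₀ E₀ x s, s) - charE P₀ E₀ x s)
      (abs_velocity_sub_le (Q (charX P₀ E₀ x s, s)) (charP P₀ E₀ x s))
      ((hC₁ s (Ioo_subset_Ioc_self hs)).trans (le_max_left _ _))
      ((hC₂ s (Ioo_subset_Ioc_self hs)).trans (le_max_right C₁ C₂))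
  exact sub_eq_zero.1 (eqOn_zero_of_norm_deriv_le
    ((h.continuousOn_sub_char x).mono (Ico_subset_Ico_right hτT.le))
    (fun s hs => h.hasDerivAt_sub_char x (Ioo_subset_Ioo_right hτT.le hs)) hbound
    (by simp [charX_zero, charP_zero, charE_zero, h.init_P, h.init_E]) ⟨ht.1, htτ⟩)

theorem IsC1Solution.eqOn {P E : ℝ × ℝ → ℝ} {T' : ℝ} (h : IsC1Solution P₀ E₀ T P E)
    (h' : IsC1Solution P₀ E₀ T' Q F) (hT : T' ≤ T) (hP : Differentiable ℝ P₀)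
    (hE : Differentiable ℝ E₀) :
    EqOn (fun q => (Q q, F q)) (fun q => (P q, E q)) (univ ×ˢ Ico 0 T') := by
  rintro ⟨ρ, t⟩ ⟨-, ht⟩
  obtain ⟨x, rfl⟩ := charX_surjective hP hE t ρ
  exact (h'.prodMk_eq_char x ht).trans (h.prodMk_eq_char x ⟨ht.1, ht.2.trans_le hT⟩).symm

theorem IsC1Solution.deriv_mul_charJ (h : IsC1Solution P₀ E₀ T Q F) {x : ℝ}
    (hP : DifferentiableAt ℝ P₀ x) (hE : DifferentiableAt ℝ E₀ x) (ht : t ∈ Ioo 0 T) :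
    (deriv (fun r => Q (r, t)) (charX P₀ E₀ x t) * charJ P₀ E₀ x t,
      deriv (fun r => F (r, t)) (charX P₀ E₀ x t) * charJ P₀ E₀ x t) =
      (charDP P₀ E₀ x t, charDE P₀ E₀ x t) := by
  have hQ := (differentiableAt_of_contDiffOn_strip h.contDiffOn_P ht (charX P₀ E₀ x t)).hasFDerivAt
  have hF := (differentiableAt_of_contDiffOn_strip h.contDiffOn_E ht (charX P₀ E₀ x t)).hasFDerivAt
  have hX := hasDerivAt_charX_space hP hE t
  have hchain :=
    ((hasDerivAt_left_of_hasFDerivAt hQ).differentiableAt.hasDerivAt.comp x hX).prodMk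
      ((hasDerivAt_left_of_hasFDerivAt hF).differentiableAt.hasDerivAt.comp x hX)
  refine hchain.unique ?_
  simpa only [Function.comp_apply, h.prodMk_eq_char _ ⟨ht.1.le, ht.2⟩] using
    hasDerivAt_char_space hP hE t

theorem IsC1Solution.one_le_abs_charJ_mul (h : IsC1Solution P₀ E₀ T Q F) {x : ℝ}
    (hP : DifferentiableAt ℝ P₀ x) (hE : DifferentiableAt ℝ E₀ x) (ht : t ∈ Ioo 0 T) :
    1 ≤ |charJ P₀ E₀ x t| * (1 + 2 * Real.exp t *
      (|deriv (fun r => Q (r, t)) (charX P₀ E₀ x t)| +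
        |deriv (fun r => F (r, t)) (charX P₀ E₀ x t)|)) := by
  have hJ := one_sub_charJ_le (P₀ := P₀) (E₀ := E₀) x t
  rw [abs_of_pos ht.1, ← h.deriv_mul_charJ hP hE ht, sub_le_iff_le_add'] at hJ
  refine hJ.trans ?_
  rw [mul_add, mul_one, mul_left_comm]
  refine add_le_add (le_abs_self _) ?_
  gcongr
  rw [Prod.norm_mk, norm_mul, norm_mul, mul_add, mul_comm |charJ P₀ E₀ x t|,
    mul_comm |charJ P₀ E₀ x t|]
  exact max_le_add_of_nonneg (by positivity) (by positivity)

theorem IsC1Solution.charJ_pos (h : IsC1Solution P₀ E₀ T Q F) {x : ℝ}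
    (hP : DifferentiableAt ℝ P₀ x) (hE : DifferentiableAt ℝ E₀ x) (ht : t ∈ Ico 0 T) :
    0 < charJ P₀ E₀ x t := by
  by_contra! hle
  obtain ⟨s, hs, hs0⟩ := intermediate_value_Icc' ht.1
    (fun s _ => (hasDerivAt_charJ (P₀ := P₀) (E₀ := E₀) x s).continuousAt.continuousWithinAt)
    ⟨hle, (charJ_zero x).ge.trans' zero_le_one⟩
  have hspos : 0 < s := hs.1.lt_of_ne' fun hs' => by simp [hs', charJ_zero] at hs0
  have hone := h.one_le_abs_charJ_mul hP hE ⟨hspos, hs.2.trans_lt ht.2⟩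
  rw [hs0, abs_zero, zero_mul] at hone
  exact not_lt_of_ge hone one_pos

end Uniqueness

section Existence

theorem contDiffWithinAt_of_leftInverse {E F : Type*} [NormedAddCommGroup E] [NormedSpace ℝ E]
    [CompleteSpace E] [NormedAddCommGroup F] [NormedSpace ℝ F] {n : WithTop ℕ∞} {Φ : E → F}
    {L : E ≃L[ℝ] F} {g : F → E} {s : Set F} {z : E} (hΦ : ContDiffAt ℝ n Φ z)
    (hL : HasFDerivAt Φ (L : E →L[ℝ] F) z) (hn : n ≠ 0) (hg : ∀ w, Φ w ∈ s → g (Φ w) = w)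
    (hz : Φ z ∈ s) : ContDiffWithinAt ℝ n g s (Φ z) := by
  let e := hΦ.toOpenPartialHomeomorph Φ hL hn
  have htarget : e.target ∈ 𝓝 (Φ z) :=
    e.open_target.mem_nhds (hΦ.image_mem_toOpenPartialHomeomorph_target hL hn)
  have heq {y : F} (hy : y ∈ s) (hye : y ∈ e.target) : g y = e.symm y := by
    have hright : Φ (e.symm y) = y := e.right_inv hye
    rw [← hg (e.symm y) (hright.symm ▸ hy), hright]
  refine (hΦ.to_localInverse hL hn).contDiffWithinAt.congr_of_eventuallyEq ?_
    (heq hz (mem_of_mem_nhds htarget))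
  filter_upwards [self_mem_nhdsWithin, mem_nhdsWithin_of_mem_nhds htarget] with y hy hye
  exact heq hy hye

/-- The shear `(x, t) ↦ (j x + v t, t)`, which for `j = ∂X/∂x` and `v = ∂X/∂t` is the derivative of
the change from Lagrangian to Eulerian coordinates. -/
noncomputable def shearEquiv {j : ℝ} (hj : j ≠ 0) (v : ℝ) : (ℝ × ℝ) ≃L[ℝ] (ℝ × ℝ) :=
  ContinuousLinearEquiv.equivOfInverse
    ((j • ContinuousLinearMap.fst ℝ ℝ ℝ + v • ContinuousLinearMap.snd ℝ ℝ ℝ).prod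
      (ContinuousLinearMap.snd ℝ ℝ ℝ))
    ((j⁻¹ • ContinuousLinearMap.fst ℝ ℝ ℝ - (j⁻¹ * v) • ContinuousLinearMap.snd ℝ ℝ ℝ).prod
      (ContinuousLinearMap.snd ℝ ℝ ℝ))
    (fun z => Prod.ext (show j⁻¹ * (j * z.1 + v * z.2) - j⁻¹ * v * z.2 = z.1 by
      field_simp; ring) rfl)
    (fun z => Prod.ext (show j * (j⁻¹ * z.1 - j⁻¹ * v * z.2) + v * z.2 = z.1 by
      field_simp; ring) rfl)

/-- The point at which the characteristic passing through `ρ` at time `t` starts. It is a junk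
value unless `charX P₀ E₀ · t` is injective. -/
noncomputable def charInv (P₀ E₀ : ℝ → ℝ) (ρ t : ℝ) : ℝ :=
  Function.invFun (fun x => charX P₀ E₀ x t) ρ

variable {P₀ E₀ : ℝ → ℝ} {T t : ℝ}

theorem charInv_charX (hP : Differentiable ℝ P₀) (hE : Differentiable ℝ E₀)
    (hJ : ∀ x, 0 < charJ P₀ E₀ x t) (x : ℝ) : charInv P₀ E₀ (charX P₀ E₀ x t) t = x := by
  have hmono : StrictMono fun x => charX P₀ E₀ x t := strictMono_of_deriv_pos fun x => by
    rw [(hasDerivAt_charX_space (hP x) (hE x) t).deriv]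
    exact hJ x
  exact Function.leftInverse_invFun hmono.injective x

theorem contDiffOn_charInv (hP : ContDiff ℝ 1 P₀) (hE : ContDiff ℝ 1 E₀)
    (hJ : ∀ t ∈ Ico 0 T, ∀ x, 0 < charJ P₀ E₀ x t) :
    ContDiffOn ℝ 1 (fun q : ℝ × ℝ => charInv P₀ E₀ q.1 q.2) (univ ×ˢ Ico 0 T) := by
  have hP' := hP.differentiable one_ne_zero
  have hE' := hE.differentiable one_ne_zero
  rintro ⟨ρ, t⟩ ⟨-, ht⟩
  obtain ⟨x, rfl⟩ := charX_surjective hP' hE' t ρ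
  have hΦ : ContDiff ℝ 1 fun q : ℝ × ℝ => (charX P₀ E₀ q.1 q.2, q.2) :=
    (contDiff_charX hP hE).prodMk contDiff_snd
  have hΦ' : HasFDerivAt (fun q : ℝ × ℝ => (charX P₀ E₀ q.1 q.2, q.2))
      (shearEquiv (hJ t ht x).ne' (velocity (charP P₀ E₀ x t)) : (ℝ × ℝ) →L[ℝ] (ℝ × ℝ)) (x, t) :=
    (hasFDerivAt_charX hP hE (x, t)).prodMk hasFDerivAt_snd
  exact (contDiffWithinAt_of_leftInverse
    (g := fun q : ℝ × ℝ => (charInv P₀ E₀ q.1 q.2, q.2)) (s := univ ×ˢ Ico 0 T)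
    hΦ.contDiffAt hΦ' one_ne_zero
    (fun q hq => Prod.ext (charInv_charX hP' hE' (hJ q.2 hq.2) q.1) rfl) ⟨mem_univ _, ht⟩).fst

theorem contDiffOn_comp_charInv (hP : ContDiff ℝ 1 P₀) (hE : ContDiff ℝ 1 E₀)
    (hJ : ∀ t ∈ Ico 0 T, ∀ x, 0 < charJ P₀ E₀ x t) {f : ℝ → ℝ → ℝ}
    (hf : ContDiff ℝ 1 fun q : ℝ × ℝ => f q.1 q.2) :
    ContDiffOn ℝ 1 (fun q : ℝ × ℝ => f (charInv P₀ E₀ q.1 q.2) q.2) (univ ×ˢ Ico 0 T) :=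
  hf.comp_contDiffOn ((contDiffOn_charInv hP hE hJ).prodMk contDiff_snd.contDiffOn)

theorem deriv_comp_charInv_add (hP : ContDiff ℝ 1 P₀) (hE : ContDiff ℝ 1 E₀)
    (hJ : ∀ t ∈ Ico 0 T, ∀ x, 0 < charJ P₀ E₀ x t) {f f' : ℝ → ℝ → ℝ}
    (hf : ContDiff ℝ 1 fun q : ℝ × ℝ => f q.1 q.2) (hf' : ∀ x, HasDerivAt (f x) (f' x t) t)
    (ht : t ∈ Ioo 0 T) (ρ : ℝ) :
    deriv (fun s => f (charInv P₀ E₀ ρ s) s) t +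
      velocity (charP P₀ E₀ (charInv P₀ E₀ ρ t) t) *
        deriv (fun r => f (charInv P₀ E₀ r t) t) ρ = f' (charInv P₀ E₀ ρ t) t := by
  have hinv (s : ℝ) (hs : s ∈ Ico 0 T) (x : ℝ) : charInv P₀ E₀ (charX P₀ E₀ x s) s = x :=
    charInv_charX (hP.differentiable one_ne_zero) (hE.differentiable one_ne_zero) (hJ s hs) x
  obtain ⟨x, rfl⟩ :=
    charX_surjective (hP.differentiable one_ne_zero) (hE.differentiable one_ne_zero) t ρ
  have hchain := hasDerivAt_comp_curve (differentiableAt_of_contDiffOn_strip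
    (contDiffOn_comp_charInv hP hE hJ hf) ht _) (hasDerivAt_charX_time (P₀ := P₀) (E₀ := E₀) x t)
  have halong : (fun s => f (charInv P₀ E₀ (charX P₀ E₀ x s) s) s) =ᶠ[𝓝 t] f x := by
    filter_upwards [Ico_mem_nhds ht.1 ht.2] with s hs
    rw [hinv s hs]
  rw [hinv t (Ioo_subset_Ico_self ht)]
  exact hchain.unique ((hf' x).congr_of_eventuallyEq halong)

theorem isC1Solution_of_charJ_pos (hP : ContDiff ℝ 1 P₀) (hE : ContDiff ℝ 1 E₀)
    (hJ : ∀ t ∈ Ico 0 T, ∀ x, 0 < charJ P₀ E₀ x t) :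
    IsC1Solution P₀ E₀ T (fun q => charP P₀ E₀ (charInv P₀ E₀ q.1 q.2) q.2)
      (fun q => charE P₀ E₀ (charInv P₀ E₀ q.1 q.2) q.2) := by
  have hinv (ρ : ℝ) : charInv P₀ E₀ ρ 0 = ρ := by
    simpa only [charX_zero] using charInv_charX (t := 0) (hP.differentiable one_ne_zero)
      (hE.differentiable one_ne_zero) (fun x => (charJ_zero x).symm ▸ one_pos) ρ
  exact
    { contDiffOn_P := contDiffOn_comp_charInv hP hE hJ (contDiff_charP hP hE)
      contDiffOn_E := contDiffOn_comp_charInv hP hE hJ (contDiff_charE hP hE)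
      eq_P := fun ρ t ht => by
        rw [deriv_comp_charInv_add hP hE hJ (contDiff_charP hP hE)
          (f' := fun x t => -charE P₀ E₀ x t)
          (fun x => (isOscillation_char x).hasDerivAt_fst t) ht, neg_add_cancel]
      eq_E := fun ρ t ht => by
        rw [deriv_comp_charInv_add hP hE hJ (contDiff_charE hP hE)
          (f' := fun x t => velocity (charP P₀ E₀ x t))
          (fun x => (isOscillation_char x).hasDerivAt_snd t) ht, sub_self]
      init_P := fun ρ => by rw [hinv, charP_zero]
      init_E := fun ρ => by rw [hinv, charE_zero] }

end Existence

section BlowUp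

variable {P₀ E₀ : ℝ → ℝ} {T : ℝ}

theorem exists_linearizedEnergy_ne_zero (hP : Differentiable ℝ P₀) (hE : Differentiable ℝ E₀)
    (hne : ¬∃ C : ℝ, ∀ ρ : ℝ, energy (P₀ ρ) (E₀ ρ) = C) :
    ∃ x, linearizedEnergy (P₀ x) (E₀ x) (deriv P₀ x) (deriv E₀ x) ≠ 0 := by
  by_contra! hzero
  have hderiv (x : ℝ) : HasDerivAt (fun x => energy (P₀ x) (E₀ x)) 0 x := by
    refine ((((hasDerivAt_sqrt_one_add_sq (P₀ x)).comp x (hP x).hasDerivAt).const_mul 2).add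
      ((hE x).hasDerivAt.pow 2)).congr_deriv ?_
    have hx := hzero x
    unfold linearizedEnergy at hx
    push_cast
    linear_combination 2 * hx
  exact hne ⟨energy (P₀ 0) (E₀ 0), fun ρ => is_const_of_deriv_eq_zero
    (fun x => (hderiv x).differentiableAt) (fun x => (hderiv x).deriv) ρ 0⟩

theorem exists_charJ_nonpos {x : ℝ}
    (hx : linearizedEnergy (P₀ x) (E₀ x) (deriv P₀ x) (deriv E₀ x) ≠ 0) :
    ∃ t, 0 ≤ t ∧ charJ P₀ E₀ x t ≤ 0 := by
  have hfreq := (isVariation_charD (P₀ := P₀) (E₀ := E₀) x).frequently_le (isOscillation_char x)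
    (by rwa [charP_zero, charE_zero, charDP_zero, charDE_zero]) (deriv E₀ x - 1)
  obtain ⟨t, hb, ht⟩ := (hfreq.and_eventually (eventually_ge_atTop 0)).exists
  exact ⟨t, ht, by unfold charJ; linarith⟩

theorem exists_abs_charJ_sub_le (hP : ∃ L, ∀ ρ, |deriv P₀ ρ| ≤ L) (hE : ∃ L, ∀ ρ, |deriv E₀ ρ| ≤ L)
    (τ : ℝ) : ∃ C, 0 < C ∧ ∀ x, ∀ s ∈ Icc 0 τ, ∀ t ∈ Icc 0 τ,
      |charJ P₀ E₀ x t - charJ P₀ E₀ x s| ≤ C * |t - s| := by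
  obtain ⟨L₁, hL₁⟩ := hP
  obtain ⟨L₂, hL₂⟩ := hE
  refine ⟨max (max L₁ L₂) 1 * Real.exp τ, by positivity, fun x s hs t ht => ?_⟩
  refine (convex_Icc 0 τ).norm_image_sub_le_of_norm_hasDerivWithin_le (f := charJ P₀ E₀ x)
    (fun r _ => (hasDerivAt_charJ x r).hasDerivWithinAt) (fun r hr => ?_) hs ht
  have hinit : ‖(charDP P₀ E₀ x 0, charDE P₀ E₀ x 0)‖ ≤ max (max L₁ L₂) 1 := by
    rw [charDP_zero, charDE_zero, Prod.norm_mk]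
    exact (max_le_max (hL₁ x) (hL₂ x)).trans (le_max_left _ _)
  calc ‖velocityDeriv (charP P₀ E₀ x r) * charDP P₀ E₀ x r‖
      ≤ ‖(charDP P₀ E₀ x r, charDE P₀ E₀ x r)‖ :=
        (norm_snd_le _).trans (norm_neg_velocityDeriv_mul_le _ (_, _))
    _ ≤ ‖(charDP P₀ E₀ x 0, charDE P₀ E₀ x 0)‖ * Real.exp |r - 0| := norm_charD_le x 0 r
    _ ≤ max (max L₁ L₂) 1 * Real.exp τ := by
        rw [sub_zero, abs_of_nonneg hr.1]
        gcongr
        exact hr.2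

/-- The first time at which neighbouring characteristics of the Cauchy problem with data `P₀`, `E₀`
meet. It has the junk value `0` if they never do. -/
noncomputable def shockTime (P₀ E₀ : ℝ → ℝ) : ℝ := sInf {t | 0 ≤ t ∧ ∃ x, charJ P₀ E₀ x t ≤ 0}

theorem shockTime_le {x t : ℝ} (ht : 0 ≤ t) (hx : charJ P₀ E₀ x t ≤ 0) : shockTime P₀ E₀ ≤ t :=
  csInf_le ⟨0, fun _ hs => hs.1⟩ ⟨ht, x, hx⟩

theorem exists_charJ_nonpos_of_shockTime_lt (hne : ∃ t, 0 ≤ t ∧ ∃ x, charJ P₀ E₀ x t ≤ 0) {t : ℝ}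
    (ht : shockTime P₀ E₀ < t) : ∃ s ∈ Ico 0 t, ∃ x, charJ P₀ E₀ x s ≤ 0 := by
  obtain ⟨s, ⟨hs, hx⟩, hst⟩ := exists_lt_of_csInf_lt hne ht
  exact ⟨s, ⟨hs, hst⟩, hx⟩

theorem shockTime_pos (hP : ∃ L, ∀ ρ, |deriv P₀ ρ| ≤ L) (hE : ∃ L, ∀ ρ, |deriv E₀ ρ| ≤ L)
    (hne : ∃ t, 0 ≤ t ∧ ∃ x, charJ P₀ E₀ x t ≤ 0) : 0 < shockTime P₀ E₀ := by
  obtain ⟨C, hC, hlip⟩ := exists_abs_charJ_sub_le hP hE 1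
  by_contra! hle
  obtain ⟨s, hs, x, hx⟩ := exists_charJ_nonpos_of_shockTime_lt hne
    (hle.trans_lt (lt_min one_pos (one_div_pos.2 hC)))
  have hdiff := (neg_abs_le _).trans' (neg_le_neg
    (hlip x 0 ⟨le_rfl, zero_le_one⟩ s ⟨hs.1, (hs.2.trans_le (min_le_left _ _)).le⟩))
  rw [charJ_zero, sub_zero, abs_of_nonneg hs.1] at hdiff
  have hsC : C * s < 1 := (lt_div_iff₀' hC).1 (hs.2.trans_le (min_le_right _ _))
  linarith

theorem IsC1Solution.le_shockTime {Q F : ℝ × ℝ → ℝ} (h : IsC1Solution P₀ E₀ T Q F)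
    (hP : Differentiable ℝ P₀) (hE : Differentiable ℝ E₀)
    (hne : ∃ t, 0 ≤ t ∧ ∃ x, charJ P₀ E₀ x t ≤ 0) : T ≤ shockTime P₀ E₀ := by
  by_contra! hlt
  obtain ⟨s, hs, x, hx⟩ := exists_charJ_nonpos_of_shockTime_lt hne hlt
  exact (h.charJ_pos (hP x) (hE x) hs).not_ge hx

theorem eventually_exists_charJ_lt (hP : ∃ L, ∀ ρ, |deriv P₀ ρ| ≤ L)
    (hE : ∃ L, ∀ ρ, |deriv E₀ ρ| ≤ L) (hne : ∃ t, 0 ≤ t ∧ ∃ x, charJ P₀ E₀ x t ≤ 0) {m : ℝ}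
    (hm : 0 < m) : ∀ᶠ t in 𝓝[<] shockTime P₀ E₀, ∃ x, charJ P₀ E₀ x t < m := by
  set T := shockTime P₀ E₀
  obtain ⟨C, hC, hlip⟩ := exists_abs_charJ_sub_le hP hE (2 * T)
  have hsmall : ∀ᶠ t in 𝓝[<] T, C * (2 * (T - t)) < m := by
    have hlim : Tendsto (fun t => C * (2 * (T - t))) (𝓝 T) (𝓝 (C * (2 * (T - T)))) :=
      Continuous.tendsto (by fun_prop) T
    rw [sub_self, mul_zero, mul_zero] at hlim
    exact (hlim.eventually_lt_const hm).filter_mono nhdsWithin_le_nhds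
  filter_upwards [hsmall, Ioo_mem_nhdsLT (shockTime_pos hP hE hne)] with t htm ht
  obtain ⟨s, hs, x, hx⟩ := exists_charJ_nonpos_of_shockTime_lt hne
    (show T < 2 * T - t by linarith [ht.2])
  have hTs : T ≤ s := shockTime_le hs.1 hx
  have hJ := (le_abs_self _).trans (hlip x s ⟨hs.1, by linarith [hs.2, ht.1]⟩ t
    ⟨ht.1.le, by linarith [ht.1, ht.2]⟩)
  have hdist : |t - s| ≤ 2 * (T - t) :=
    abs_le.2 ⟨by linarith [hs.2], by linarith [ht.2]⟩
  have hCdist := mul_le_mul_of_nonneg_left hdist hC.le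
  exact ⟨x, by linarith⟩

theorem IsC1Solution.tendsto_gradSup {P E : ℝ × ℝ → ℝ} (h : IsC1Solution P₀ E₀ T P E)
    (hP : Differentiable ℝ P₀) (hE : Differentiable ℝ E₀) (hT : 0 < T)
    (hJ : ∀ m > 0, ∀ᶠ t in 𝓝[<] T, ∃ x, charJ P₀ E₀ x t < m) :
    Tendsto (gradSup P E) (𝓝[<] T) (𝓝 ⊤) := by
  rw [ENNReal.tendsto_nhds_top_iff_nnreal]
  intro M
  have hpos : 0 < 1 + 2 * Real.exp T * M := by positivity
  filter_upwards [hJ _ (one_div_pos.2 hpos), Ioo_mem_nhdsLT hT] with t ⟨x, hx⟩ ht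
  refine lt_of_lt_of_le ?_ (le_iSup _ (charX P₀ E₀ x t))
  rw [← ENNReal.ofReal_coe_nnreal, ENNReal.ofReal_lt_ofReal_iff_of_nonneg M.coe_nonneg]
  by_contra! hle
  have hone := h.one_le_abs_charJ_mul (hP x) (hE x) ht
  have hJpos := h.charJ_pos (hP x) (hE x) (Ioo_subset_Ico_self ht)
  rw [abs_of_pos hJpos] at hone
  refine hone.not_gt (lt_of_le_of_lt ?_ ((lt_div_iff₀ hpos).1 hx))
  gcongr
  exact ht.2.le

theorem derivativesBlowUpAt_shockTime (hP : IsAdmissibleDatum P₀) (hE : IsAdmissibleDatum E₀)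
    (hne : ∃ t, 0 ≤ t ∧ ∃ x, charJ P₀ E₀ x t ≤ 0) :
    DerivativesBlowUpAt P₀ E₀ (shockTime P₀ E₀) := by
  have hP' := hP.1.differentiable one_ne_zero
  have hE' := hE.1.differentiable one_ne_zero
  have hpos := shockTime_pos hP.2 hE.2 hne
  have hsol := isC1Solution_of_charJ_pos (T := shockTime P₀ E₀) hP.1 hE.1 fun t ht x => by
    by_contra! hle
    exact (shockTime_le ht.1 hle).not_gt ht.2
  refine ⟨hpos, _, _, hsol, fun T' Q F hQF => ?_, hsol.tendsto_gradSup hP' hE' hpos fun m hm =>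
    eventually_exists_charJ_lt hP.2 hE.2 hne hm⟩
  have hle := hQF.le_shockTime hP' hE' hne
  have heq := hsol.eqOn hQF hle hP' hE'
  exact ⟨hle, fun q hq => congrArg Prod.fst (heq hq), fun q hq => congrArg Prod.snd (heq hq)⟩

end BlowUp

end ColdPlasma

theorem mainTheorem5_general {P₀ E₀ : ℝ → ℝ} (hP : ColdPlasma.IsAdmissibleDatum P₀)
    (hE : ColdPlasma.IsAdmissibleDatum E₀)
    (hne : ¬∃ C : ℝ, ∀ ρ : ℝ, ColdPlasma.energy (P₀ ρ) (E₀ ρ) = C) :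
    ∃ T : ℝ, ColdPlasma.DerivativesBlowUpAt P₀ E₀ T := by
  obtain ⟨x, hx⟩ := ColdPlasma.exists_linearizedEnergy_ne_zero
    (hP.1.differentiable one_ne_zero) (hE.1.differentiable one_ne_zero) hne
  obtain ⟨t, ht, hJ⟩ := ColdPlasma.exists_charJ_nonpos hx
  exact ⟨_, ColdPlasma.derivativesBlowUpAt_shockTime hP hE ⟨t, ht, x, hJ⟩⟩

theorem mainTheorem5 :
    ∃ ε : ℝ, 0 < ε ∧ ∀ P₀ E₀ : ℝ → ℝ,
      ColdPlasma.IsAdmissibleDatum P₀ → ColdPlasma.IsAdmissibleDatum E₀ →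
      (∀ ρ : ℝ, |P₀ ρ| ≤ ε ∧ |E₀ ρ| ≤ ε) →
      (¬ ∃ C : ℝ, ∀ ρ : ℝ, ColdPlasma.energy (P₀ ρ) (E₀ ρ) = C) →
      ∃ T : ℝ, ColdPlasma.DerivativesBlowUpAt P₀ E₀ T :=
  ⟨1, one_pos, fun _ _ hP hE _ hne => mainTheorem5_general hP hE hne⟩
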